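/- **Setting.** Let $L$ be a (possibly infinite) language consisting of relation symbols $R$ of arities $a(R)\ge 1$ and unary function symbols $F$, equipped with a permutation group $\Gamma_L$ on $L$ that preserves types and arities. A *$\Gamma_L$-structure* $\mathbf A$ has a finite or countably infinite (possibly empty) vertex set $A$, relations $R_{\mathbf A}\subseteq A^{a(R)}$ and functions $F_{\mathbf A}\colon A\to\mathcal P(A)$. A *homomorphism* $f\colon\mathbf A\to\mathbf B$ is a pair $(f_L,f_A)$ with $f_L\in\Gamma_L$, $f_A\colon A\to B$, such that $\bar x\in R_{\mathbf A}$ implies $f_A(\bar x)\in f_L(R)_{\mathbf B}$, and $f_A(F_{\mathbf A}(x))\subseteq f_L(F)_{\mathbf B}(f_A(x))$. It is an *embedding* if $f_A$ is injective, the implication is an equivalence and the inclusion is an equality; a bijective embedding is an *isomorphism*, and an isomorphism $\mathbf A\to\mathbf A$ is an *automorphism*. Morphisms are composed in both components. A *substructure* of $\mathbf A$ is the structure induced on a subset of $A$ closed under all functions. A structure is *irreducible* if its vertex set is not the union of the vertex sets $S,T$ of two proper substructures such that no tuple in a relation meets both $S\setminus T$ and $T\setminus S$. A *homomorphism-embedding*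 is a homomorphism whose restriction to every irreducible substructure of its domain is an embedding. For a family $\mathcal F$ of structures, $\mathrm{Forb}_{he}(\mathcal F)$ is the class of all finite or countably infinite $\Gamma_L$-structures to which no $\mathbf F\in\mathcal F$ has a homomorphism-embedding. The group $\Gamma_L$ acts on the structures with a given vertex set *by relabelling*: $R_{g\mathbf A}=(g^{-1}R)_{\mathbf A}$ and $F_{g\mathbf A}=(g^{-1}F)_{\mathbf A}$. A *partial automorphism* of $\mathbf A$ is an isomorphism between two substructures of $\mathbf A$ (it includes an element of $\Gamma_L$; an automorphism extending it has the same language part). A triple $(f,g,h)$ of partial automorphisms is *coherent* if $\mathrm{Dom}(f)=\mathrm{Dom}(h)$, $\mathrm{Range}(f)=\mathrm{Dom}(g)$, $\mathrm{Range}(g)=\mathrm{Range}(h)$ and $h=g\circ f$. A finite structure $\mathbf B$ with an embedding $\psi\colon\mathbf A\to\mathbf B$ is a *coherent EPPA-witness* for $\mathbf A$ if there is a map $f\mapsto\hat f$ from the partial automorphisms of $\psi(\mathbf A)$ to $\mathrm{Aut}(\mathbf B)$ such that $\hat f$ extends $f$ and coherent triples are sent to coherent triples. It is *irreducible structure faithful*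 if for every irreducible substructure $\mathbf C$ of $\mathbf B$ there is $g\in\mathrm{Aut}(\mathbf B)$ with $g(C)\subseteq\psi(A)$. **Theorem.** Let $\mathcal F$ be a finite family of finite $\Gamma_L$-structures and let $\mathbf A\in\mathrm{Forb}_{he}(\mathcal F)$ be a finite $\Gamma_L$-structure which lies in a finite orbit of the action of $\Gamma_L$ by relabelling. If there exists a (finite or countably infinite) structure $\mathbf M\in\mathrm{Forb}_{he}(\mathcal F)$ containing $\mathbf A$ as a substructure such that each partial automorphism of $\mathbf A$ extends to an automorphism of $\mathbf M$, then there exists a finite structure $\mathbf B\in\mathrm{Forb}_{he}(\mathcal F)$ which is an irreducible structure faithful coherent EPPA-witness for $\mathbf A$ (with respect to one and the same embedding $\psi\colon\mathbf A\to\mathbf B$). -/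

import Mathlib

namespace EPPA

universe u v w w'

/-- A language consisting of relation symbols (`Rel n` is the set of relation symbols of arity
`n ≥ 1`) and unary function symbols (`Fn`), equipped with a permutation group `Γ`. Since the
permutations are given arity by arity and separately on relations and functions, these are exactly
the permutation groups on the symbols which preserve types and arities. -/
structure PermLanguage where
  Rel : ℕ+ → Type u
  Fn : Type v
  Γ : Subgroup ((∀ n : ℕ+, Equiv.Perm (Rel n)) × Equiv.Perm Fn)

namespace PermLanguage

/-- The image of a relation symbol under an element of the permutation group. -/
def onRel (L : PermLanguage.{u, v}) (g : L.Γ) {n : ℕ+} (R : L.Rel n) : L.Rel n :=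
  (g : (∀ n : ℕ+, Equiv.Perm (L.Rel n)) × Equiv.Perm L.Fn).1 n R

/-- The image of a function symbol under an element of the permutation group. -/
def onFn (L : PermLanguage.{u, v}) (g : L.Γ) (F : L.Fn) : L.Fn :=
  (g : (∀ n : ℕ+, Equiv.Perm (L.Rel n)) × Equiv.Perm L.Fn).2 F

end PermLanguage

/-- A `Γ_L`-structure with vertex set `V`: relations are sets of tuples, functions map vertices to
sets of vertices. The vertex set may be empty. -/
@[ext]
structure Str (L : PermLanguage.{u, v}) (V : Type w) where
  rel : ∀ {n : ℕ+}, L.Rel n → Set (Fin (n : ℕ) → V)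
  fn : L.Fn → V → Set V

namespace Str

variable {L : PermLanguage.{u, v}} {V : Type w} {W : Type w'}

/-- The structure `g A`: the relations and functions of `A` relabelled according to `g`. -/
def relabel (g : L.Γ) (A : Str L V) : Str L V where
  rel R := A.rel (L.onRel g⁻¹ R)
  fn F := A.fn (L.onFn g⁻¹ F)

/-- The action of `Γ_L` on the `Γ_L`-structures with vertex set `V` by relabelling. -/
instance : MulAction L.Γ (Str L V) where
  smul g A := A.relabel g
  one_smul A := by
    change A.relabel 1 = A
    ext <;> simp [relabel, PermLanguage.onRel, PermLanguage.onFn]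
  mul_smul g h A := by
    change A.relabel (g * h) = (A.relabel h).relabel g
    ext <;> simp [relabel, PermLanguage.onRel, PermLanguage.onFn]

/-- `(g, f)` is a homomorphism `A → B`. -/
structure IsHom (A : Str L V) (B : Str L W) (g : L.Γ) (f : V → W) : Prop where
  map_rel : ∀ {n : ℕ+} (R : L.Rel n) (x : Fin (n : ℕ) → V),
    x ∈ A.rel R → f ∘ x ∈ B.rel (L.onRel g R)
  map_fn : ∀ (F : L.Fn) (x : V), f '' A.fn F x ⊆ B.fn (L.onFn g F) (f x)

/-- `(g, f)` is an embedding `A → B`. -/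
structure IsEmbedding (A : Str L V) (B : Str L W) (g : L.Γ) (f : V → W) : Prop where
  injective : Function.Injective f
  map_rel : ∀ {n : ℕ+} (R : L.Rel n) (x : Fin (n : ℕ) → V),
    x ∈ A.rel R ↔ f ∘ x ∈ B.rel (L.onRel g R)
  map_fn : ∀ (F : L.Fn) (x : V), f '' A.fn F x = B.fn (L.onFn g F) (f x)

/-- `S` is the vertex set of a substructure of `A`, that is, it is closed under the functions. -/
def IsClosed (A : Str L V) (S : Set V) : Prop :=
  ∀ (F : L.Fn), ∀ x ∈ S, A.fn F x ⊆ S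

/-- The structure induced by `A` on `S`. It is the substructure of `A` with vertex set `S` when
`S` is closed, and it is only used for closed `S`. -/
def induce (A : Str L V) (S : Set V) : Str L S where
  rel R := {x | (fun i => (x i : V)) ∈ A.rel R}
  fn F x := {y | (y : V) ∈ A.fn F x}

/-- `A` is the free amalgamation of its substructures with vertex sets `S` and `T` (over their
intersection). The condition on the functions in the definition of free amalgamation concerns
tuples that contain vertices of both `S \ T` and `T \ S`, so it is void for unary functions. -/
structure IsFreeAmalgamation (A : Str L V) (S T : Set V) : Prop where
  closed_left : A.IsClosed S
  closed_right : A.IsClosed T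
  union_eq : S ∪ T = Set.univ
  free : ∀ {n : ℕ+} (R : L.Rel n), ∀ x ∈ A.rel R,
    ¬ ((∃ i, x i ∈ S \ T) ∧ (∃ j, x j ∈ T \ S))

/-- A structure is irreducible if it is not the free amalgamation of two of its proper
substructures. -/
def Irreducible (A : Str L V) : Prop :=
  ¬ ∃ S T : Set V, S ≠ Set.univ ∧ T ≠ Set.univ ∧ A.IsFreeAmalgamation S T

/-- `(g, f)` is a homomorphism-embedding `A → B`: a homomorphism whose restriction to each
irreducible substructure of `A` is an embedding. -/
structure IsHomEmbedding (A : Str L V) (B : Str L W) (g : L.Γ) (f : V → W) : Prop where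
  isHom : A.IsHom B g f
  isEmbedding_restrict : ∀ S : Set V, A.IsClosed S → (A.induce S).Irreducible →
    (A.induce S).IsEmbedding B g (fun x : S => f x)

/-- Membership in `Forb_he(F)`: the finite or countably infinite structures to which no member of
the family `F` has a homomorphism-embedding. -/
def ForbHE {ι : Type*} {U : ι → Type*} (F : ∀ i, Str L (U i)) (A : Str L V) : Prop :=
  Countable V ∧ ¬ ∃ (i : ι) (g : L.Γ) (f : U i → V), (F i).IsHomEmbedding A g f

/-- Embeddings `A → B`, with both the language part and the vertex part. -/
structure Emb (A : Str L V) (B : Str L W) where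
  perm : L.Γ
  toFun : V → W
  isEmbedding : A.IsEmbedding B perm toFun

/-- Automorphisms of `B`, with both the language part and the vertex part. -/
structure Aut (B : Str L W) where
  perm : L.Γ
  toEquiv : Equiv.Perm W
  isEmbedding : B.IsEmbedding B perm toEquiv

/-- Partial automorphisms of `A`: isomorphisms between two substructures of `A`. -/
structure PartialAut (A : Str L V) where
  perm : L.Γ
  dom : Set V
  cod : Set V
  dom_closed : A.IsClosed dom
  cod_closed : A.IsClosed cod
  toEquiv : dom ≃ cod
  isEmbedding : (A.induce dom).IsEmbedding (A.induce cod) perm toEquiv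

/-- The automorphism `e` of `B` extends `ψ ∘ f ∘ ψ⁻¹`, where `f` is a partial automorphism of `A`
and `ψ : A → B` is an embedding. The partial automorphisms of the substructure `ψ(A)` of `B` are
exactly the maps `ψ ∘ f ∘ ψ⁻¹` with `f` a partial automorphism of `A`; when the language part of
`ψ` is trivial and `ψ` is regarded as an inclusion, this says that `e` extends `f`. -/
def Aut.Extends {A : Str L V} {B : Str L W} (e : B.Aut) (ψ : A.Emb B) (f : A.PartialAut) : Prop :=
  e.perm = ψ.perm * f.perm * ψ.perm⁻¹ ∧
    ∀ x : f.dom, e.toEquiv (ψ.toFun x) = ψ.toFun (f.toEquiv x)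

/-- `(f, g, h)` is a coherent triple of partial automorphisms: the domains and ranges fit together
and `h = g ∘ f` (in the language part and in the vertex part). -/
structure PartialAut.IsCoherentTriple {A : Str L V} (f g h : A.PartialAut) : Prop where
  dom_eq : f.dom = h.dom
  mid_eq : f.cod = g.dom
  cod_eq : g.cod = h.cod
  perm_eq : h.perm = g.perm * f.perm
  map_eq : ∀ (x : f.dom) (y : g.dom) (z : h.dom),
    (z : V) = x → (y : V) = f.toEquiv x → (h.toEquiv z : V) = g.toEquiv y

/-- `(f, g, h)` is a coherent triple of automorphisms; the domains and ranges all being the whole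
vertex set, this only means `h = g ∘ f`. -/
structure Aut.IsCoherentTriple {B : Str L W} (f g h : B.Aut) : Prop where
  perm_eq : h.perm = g.perm * f.perm
  map_eq : ∀ x, h.toEquiv x = g.toEquiv (f.toEquiv x)

/-- `ψ : A → B` makes `B` a coherent EPPA-witness for `A`: the partial automorphisms of `ψ(A)`
extend to automorphisms of `B` by a coherent map. -/
def IsCoherentEPPAWitness {A : Str L V} {B : Str L W} (ψ : A.Emb B) : Prop :=
  ∃ φ : A.PartialAut → B.Aut, (∀ f, (φ f).Extends ψ f) ∧
    ∀ f g h : A.PartialAut, f.IsCoherentTriple g h → (φ f).IsCoherentTriple (φ g) (φ h)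

/-- `B` is irreducible structure faithful with respect to `ψ(A)`: each irreducible substructure of
`B` is mapped into `ψ(A)` by some automorphism of `B`. -/
def IsIrreducibleStructureFaithful {A : Str L V} {B : Str L W} (ψ : A.Emb B) : Prop :=
  ∀ C : Set W, B.IsClosed C → (B.induce C).Irreducible →
    ∃ e : B.Aut, e.toEquiv '' C ⊆ Set.range ψ.toFun

end Str

end EPPA

/-!
`B` is a union of finitely many copies of `A`, the charts. Partial isomorphisms between charts have
to extend functorially; this is achieved throughout by permutations which are order-preserving
wherever they are not prescribed. Starting from all bijections of the vertex set, `B` is built by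
labelling the points of the charts again and again.

* The first labels are taken modulo a prime. Their sums over sets of points encode which structures
  of the orbit of `A` agree with the chart there, so that charts agree where they overlap. There are
  finitely many labels because the orbit is finite.
* The further labels colour the points by a family of partial colourings, one for every relation on
  the old points which looks like the relation of having the same colour on every single chart, but
  need not come from a colouring of all points. Such a relation with `q` colours is equality on a
  set of `q + 1` points which lie in no common chart, so that these points cannot be relabelled to
  be pairwise in a common chart. In the end sets of points which are pairwise in a common chart lie
  in a chart, and irreducible substructures are of this kind.
* The relations with two colours show in the same way that two points of a set `C` without a common
  chart are separated within `C` by points of a single chart, unless the projection of `C` to the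
  old points already has fewer pairs without a common chart. Hence a small set can be mapped to `M`
  by gluing maps along charts, which is possible because `M` is homogeneous with respect to `A`. A
  homomorphism-embedding of a forbidden structure into `B` would thus give one into `M`.
-/

namespace EPPA

/-! ### Canonical extensions of partial injections -/

section CanonicalExtension

variable {X I J : Type*} [LinearOrder X]

/-- The permutation `e` maps `a i` to `b i` and is increasing elsewhere. On a finite set these
conditions determine `e`, which makes the extension of partial injections functorial. -/
structure IsCanonicalExtension (a b : I → X) (e : Equiv.Perm X) : Prop where
  apply_eq : ∀ i, e (a i) = b i
  strictMonoOn : StrictMonoOn e (Set.range a)ᶜ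

theorem IsCanonicalExtension.image_compl_range {a b : I → X} {e : Equiv.Perm X}
    (he : IsCanonicalExtension a b e) : e '' (Set.range a)ᶜ = (Set.range b)ᶜ := by
  rw [Set.image_compl_eq e.bijective, ← Set.range_comp]
  exact congrArg (fun c => (Set.range c)ᶜ) (funext he.apply_eq)

theorem isCanonicalExtension_one (a : I → X) : IsCanonicalExtension a a 1 :=
  ⟨fun _ => rfl, strictMono_id.strictMonoOn _⟩

theorem IsCanonicalExtension.mul {a b c : I → X} {e e' : Equiv.Perm X}
    (he' : IsCanonicalExtension b c e') (he : IsCanonicalExtension a b e) :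
    IsCanonicalExtension a c (e' * e) where
  apply_eq i := by rw [Equiv.Perm.mul_apply, he.apply_eq, he'.apply_eq]
  strictMonoOn := he'.strictMonoOn.comp he.strictMonoOn fun _ hx =>
    he.image_compl_range ▸ Set.mem_image_of_mem e hx

theorem IsCanonicalExtension.unique [WellFoundedLT X] {a b : I → X} {e e' : Equiv.Perm X}
    (he : IsCanonicalExtension a b e) (he' : IsCanonicalExtension a b e') : e = e' := by
  have hrange : Set.range ((Set.range a)ᶜ.domRestrict e) =
      Set.range ((Set.range a)ᶜ.domRestrict e') := by
    rw [Set.range_domRestrict, Set.range_domRestrict, he.image_compl_range, he'.image_compl_range]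
  have hcompl := (he.strictMonoOn.domRestrict.range_inj he'.strictMonoOn.domRestrict).1 hrange
  ext x
  by_cases hx : x ∈ Set.range a
  · obtain ⟨i, rfl⟩ := hx
    rw [he.apply_eq, he'.apply_eq]
  · exact congrFun hcompl ⟨x, hx⟩

theorem isCanonicalExtension_comp_iff {a b : I → X} {s : J → I} (hs : Function.Surjective s)
    {e : Equiv.Perm X} :
    IsCanonicalExtension (a ∘ s) (b ∘ s) e ↔ IsCanonicalExtension a b e := by
  refine ⟨fun h => ⟨hs.forall.2 h.apply_eq, ?_⟩, fun h => ⟨fun j => h.apply_eq (s j), ?_⟩⟩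
  · simpa only [hs.range_comp] using h.strictMonoOn
  · simpa only [hs.range_comp] using h.strictMonoOn

theorem exists_isCanonicalExtension [Finite X] {a b : I → X} (hab : ∀ i j, a i = a j ↔ b i = b j) :
    ∃ e, IsCanonicalExtension a b e := by
  classical
  have := Fintype.ofFinite X
  let r : {x // x ∈ Set.range a} ≃ {x // x ∈ Set.range b} :=
    (Setoid.quotientKerEquivRange a).symm.trans
      ((Quotient.congrRight hab).trans (Setoid.quotientKerEquivRange b))
  have hr (i : I) : r ⟨a i, i, rfl⟩ = ⟨b i, i, rfl⟩ := by
    have : (Setoid.quotientKerEquivRange a).symm ⟨a i, i, rfl⟩ = Quotient.mk _ i := by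
      rw [Equiv.symm_apply_eq]; rfl
    simp only [r, Equiv.trans_apply, this]
    rfl
  let c : {x // x ∉ Set.range a} ≃o {x // x ∉ Set.range b} :=
    (Fintype.orderIsoFinOfCardEq _ rfl).symm.trans
      (Fintype.orderIsoFinOfCardEq _ (Fintype.card_congr r.toCompl).symm)
  refine ⟨r.subtypeCongr c.toEquiv, fun i => ?_, fun x hx y hy hxy => ?_⟩
  · simp [Equiv.subtypeCongr, hr, Equiv.sumCompl]
  · have hcx (x) (hx : x ∉ Set.range a) : r.subtypeCongr c.toEquiv x = c ⟨x, hx⟩ := by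
      simp [Equiv.subtypeCongr, hx]
    rw [hcx x hx, hcx y hy]
    exact c.strictMono (show (⟨x, hx⟩ : {x // x ∉ Set.range a}) < ⟨y, hy⟩ from hxy)

open Classical in
/-- The canonical permutation which maps `a i` to `b i`, or the identity if no permutation does. -/
noncomputable def canonicalPerm (a b : I → X) : Equiv.Perm X :=
  if h : ∃ e, IsCanonicalExtension a b e then h.choose else 1

theorem isCanonicalExtension_canonicalPerm [Finite X] {a b : I → X}
    (hab : ∀ i j, a i = a j ↔ b i = b j) : IsCanonicalExtension a b (canonicalPerm a b) := by
  have h := exists_isCanonicalExtension hab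
  rw [canonicalPerm, dif_pos h]
  exact h.choose_spec

theorem canonicalPerm_self [Finite X] (a : I → X) : canonicalPerm a a = 1 :=
  have := Finite.to_wellFoundedLT (α := X)
  (isCanonicalExtension_canonicalPerm fun _ _ => Iff.rfl).unique (isCanonicalExtension_one a)

theorem canonicalPerm_mul [Finite X] {a b c : I → X} (hab : ∀ i j, a i = a j ↔ b i = b j)
    (hbc : ∀ i j, b i = b j ↔ c i = c j) :
    canonicalPerm b c * canonicalPerm a b = canonicalPerm a c :=
  have := Finite.to_wellFoundedLT (α := X)
  ((isCanonicalExtension_canonicalPerm hbc).mul (isCanonicalExtension_canonicalPerm hab)).unique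
    (isCanonicalExtension_canonicalPerm fun i j => (hab i j).trans (hbc i j))

theorem canonicalPerm_comp (a b : I → X) {s : J → I} (hs : Function.Surjective s) :
    canonicalPerm (a ∘ s) (b ∘ s) = canonicalPerm a b := by
  have h : IsCanonicalExtension (a ∘ s) (b ∘ s) = IsCanonicalExtension a b :=
    funext fun _ => propext (isCanonicalExtension_comp_iff hs)
  rw [canonicalPerm, h, canonicalPerm]

end CanonicalExtension

/-! ### Partial colourings -/

section Colour

variable {X I J : Type*}

/-- The relation of having the same colour in a partial colouring, where `⊥` stands for the absence
of a colour. -/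
def SameColour (l : I → WithBot X) (i j : I) : Prop := l i ≠ ⊥ ∧ l i = l j

theorem sameColour_self_iff {l : I → WithBot X} {i : I} : SameColour l i i ↔ l i ≠ ⊥ :=
  and_iff_left rfl

theorem sameColour_perm_comp_iff {e : Equiv.Perm (WithBot X)} (he : e ⊥ = ⊥) {l : I → WithBot X}
    {i j : I} : SameColour (e ∘ l) i j ↔ SameColour l i j := by
  have hbot : e (l i) = ⊥ ↔ l i = ⊥ := by rw [← e.apply_eq_iff_eq (x := l i), he]
  simp only [SameColour, Function.comp_apply, ne_eq, hbot, e.apply_eq_iff_eq]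

theorem elim_bot_eq_elim_bot_iff {a b : I → WithBot X}
    (hab : ∀ i j, SameColour a i j ↔ SameColour b i j) (o o' : Option I) :
    o.elim ⊥ a = o'.elim ⊥ a ↔ o.elim ⊥ b = o'.elim ⊥ b := by
  have hbot (i) : a i = ⊥ ↔ b i = ⊥ := by
    rw [← not_iff_not, ← ne_eq, ← ne_eq, ← sameColour_self_iff, hab, sameColour_self_iff]
  have hcolour (i j) : a i = a j ↔ b i = b j := by
    by_cases hi : a i = ⊥
    · rw [hi, (hbot i).1 hi, eq_comm, hbot, eq_comm]
    · simpa [SameColour, hi, (hbot i).not.1 hi] using hab i j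
  cases o <;> cases o' <;> simp [hbot, hcolour, eq_comm (a := ⊥)]

variable [LinearOrder X]

/-- The canonical permutation of the colours which fixes `⊥` and maps `a i` to `b i`. -/
noncomputable def colourPerm (a b : I → WithBot X) : Equiv.Perm (WithBot X) :=
  canonicalPerm (fun o : Option I => o.elim ⊥ a) fun o => o.elim ⊥ b

theorem colourPerm_comp (a b : I → WithBot X) {s : J → I} (hs : Function.Surjective s) :
    colourPerm (a ∘ s) (b ∘ s) = colourPerm a b := by
  have hmap : Function.Surjective (Option.map s)
    | none => ⟨none, rfl⟩
    | some i => (hs i).imp' some fun _ => congrArg some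
  rw [colourPerm, colourPerm, ← canonicalPerm_comp _ _ hmap]
  congr 1 <;> funext o <;> cases o <;> rfl

variable [Finite X] {a b c : I → WithBot X}

theorem colourPerm_apply (hab : ∀ i j, SameColour a i j ↔ SameColour b i j) (i : I) :
    colourPerm a b (a i) = b i :=
  (isCanonicalExtension_canonicalPerm (elim_bot_eq_elim_bot_iff hab)).apply_eq (some i)

theorem colourPerm_bot (hab : ∀ i j, SameColour a i j ↔ SameColour b i j) :
    colourPerm a b ⊥ = ⊥ :=
  (isCanonicalExtension_canonicalPerm (elim_bot_eq_elim_bot_iff hab)).apply_eq none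

theorem colourPerm_self (a : I → WithBot X) : colourPerm a a = 1 := canonicalPerm_self _

theorem colourPerm_mul (hab : ∀ i j, SameColour a i j ↔ SameColour b i j)
    (hbc : ∀ i j, SameColour b i j ↔ SameColour c i j) :
    colourPerm b c * colourPerm a b = colourPerm a c :=
  canonicalPerm_mul (elim_bot_eq_elim_bot_iff hab) (elim_bot_eq_elim_bot_iff hbc)

end Colour

/-! ### Vertex separators -/

section Separation

variable {α β : Type*}

/-- Disjoint parts `P` and `Q` of `C`, containing `u` and `v`, with no edges between them. The
separator is the rest of `C`. -/
structure Separates (R : α → α → Prop) (C : Set α) (u v : α) (P Q : Set α) : Prop where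
  left_mem : u ∈ P
  right_mem : v ∈ Q
  left_subset : P ⊆ C
  right_subset : Q ⊆ C
  disjoint : Disjoint P Q
  not_adj : ∀ p ∈ P, ∀ q ∈ Q, ¬R p q

/-- A separation whose separator has as few elements as possible. -/
structure MaximallySeparates (R : α → α → Prop) (C : Set α) (u v : α) (P Q : Set α) : Prop
    extends Separates R C u v P Q where
  ncard_le : ∀ {P' Q'}, Separates R C u v P' Q' → (P' ∪ Q').ncard ≤ (P ∪ Q).ncard

variable {R : α → α → Prop} {C P Q : Set α} {u v : α}

theorem Separates.symm [Std.Symm R] (h : Separates R C u v P Q) :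
    Separates R C v u Q P where
  left_mem := h.right_mem
  right_mem := h.left_mem
  left_subset := h.right_subset
  right_subset := h.left_subset
  disjoint := h.disjoint.symm
  not_adj q hq p hp hqp := h.not_adj p hp q hq (_root_.symm hqp)

theorem MaximallySeparates.symm [Std.Symm R] (h : MaximallySeparates R C u v P Q) :
    MaximallySeparates R C v u Q P where
  toSeparates := h.toSeparates.symm
  ncard_le h' := by
    rw [Set.union_comm, Set.union_comm Q]
    exact h.ncard_le h'.symm

variable [Finite α]

theorem exists_maximallySeparates (hu : u ∈ C) (hv : v ∈ C) (huv : u ≠ v) (hR : ¬R u v) :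
    ∃ P Q, MaximallySeparates R C u v P Q := by
  have hsep : Separates R C u v {u} {v} :=
    ⟨rfl, rfl, by simpa, by simpa, by simpa using huv, by simpa⟩
  obtain ⟨⟨P, Q⟩, h, hmax⟩ := Set.exists_max_image {p : Set α × Set α | Separates R C u v p.1 p.2}
    (fun p => (p.1 ∪ p.2).ncard) (Set.toFinite _) ⟨⟨_, _⟩, hsep⟩
  exact ⟨P, Q, h, fun h' => hmax ⟨_, _⟩ h'⟩

/-- Otherwise `r` could be added to `Q`, together with `P \ P'`. -/
theorem MaximallySeparates.exists_adj [Std.Symm R] (h : MaximallySeparates R C u v P Q)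
    {P' : Set α} (hP' : P' ⊆ P) (hu : u ∈ P') (hno : ∀ p ∈ P', ∀ p' ∈ P \ P', ¬R p p') {r : α}
    (hr : r ∈ C \ (P ∪ Q)) : ∃ p ∈ P', R r p := by
  by_contra! hrP'
  have hsep : Separates R C u v P' (insert r (Q ∪ P \ P')) := by
    refine ⟨hu, .inr (.inl h.right_mem), hP'.trans h.left_subset, ?_, ?_, ?_⟩
    · exact Set.insert_subset hr.1
        (Set.union_subset h.right_subset (Set.sdiff_subset.trans h.left_subset))
    · rw [Set.disjoint_insert_right, Set.disjoint_union_right]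
      exact ⟨fun hr' => hr.2 (.inl (hP' hr')), h.disjoint.mono_left hP', Set.disjoint_sdiff_right⟩
    · rintro p hp q (rfl | hq | hq) hpq
      exacts [hrP' p hp (_root_.symm hpq), h.not_adj p (hP' hp) q hq hpq, hno p hp q hq hpq]
  have hunion : P' ∪ insert r (Q ∪ P \ P') = insert r (P ∪ Q) := by
    rw [Set.union_insert, Set.union_comm Q, ← Set.union_assoc, Set.union_sdiff_cancel hP']
  have hle := h.ncard_le hsep
  rw [hunion, Set.ncard_insert_of_notMem hr.2] at hle
  exact Nat.not_succ_le_self _ hle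

theorem MaximallySeparates.exists_adj_of_colouring [Std.Symm R]
    (h : MaximallySeparates R C u v P Q) {κ : α → β}
    (hκ : ∀ a ∈ P, ∀ b ∈ P, R a b → κ a = κ b) {r : α} (hr : r ∈ C \ (P ∪ Q)) :
    ∃ p ∈ P, κ p = κ u ∧ R r p := by
  obtain ⟨p, ⟨hp, hpu⟩, hrp⟩ := h.exists_adj (P' := {p ∈ P | κ p = κ u})
    (Set.sep_subset _ _) ⟨h.left_mem, rfl⟩
    (fun p hp p' hp' hpp' => hp'.2 ⟨hp'.1, (hκ p hp.1 p' hp'.1 hpp').symm.trans hp.2⟩) hr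
  exact ⟨p, hp, hpu, hrp⟩

/-- The vertices `s` and `t` lie on a closed walk through `P` and `Q`; if the colours agree along
all its edges but one, then they agree along the last edge. -/
theorem MaximallySeparates.exists_adj_eq [Std.Symm R] (h : MaximallySeparates R C u v P Q)
    {s t : α} (hs : s ∈ C \ (P ∪ Q)) (ht : t ∈ C \ (P ∪ Q)) {κ : α → β}
    (hP : ∀ a ∈ insert s (insert t P), ∀ p ∈ P, R a p → κ a = κ p)
    (hQ : ∀ a ∈ insert t Q, ∀ q ∈ Q, R a q → κ a = κ q) : ∃ q ∈ Q, R s q ∧ κ s = κ q := by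
  have hPP : ∀ a ∈ P, ∀ b ∈ P, R a b → κ a = κ b := fun a ha => hP a (.inr (.inr ha))
  have hQQ : ∀ a ∈ Q, ∀ b ∈ Q, R a b → κ a = κ b := fun a ha => hQ a (.inr ha)
  have hs' := Set.union_comm P Q ▸ hs
  have ht' := Set.union_comm P Q ▸ ht
  obtain ⟨p, hp, hpu, hsp⟩ := h.exists_adj_of_colouring hPP hs
  obtain ⟨p', hp', hpu', htp'⟩ := h.exists_adj_of_colouring hPP ht
  obtain ⟨q, hq, hqv, hsq⟩ := h.symm.exists_adj_of_colouring hQQ hs'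
  obtain ⟨q', hq', hqv', htq'⟩ := h.symm.exists_adj_of_colouring hQQ ht'
  refine ⟨q, hq, hsq, ?_⟩
  calc κ s = κ u := (hP s (.inl rfl) p hp hsp).trans hpu
    _ = κ t := ((hP t (.inr (.inl rfl)) p' hp' htp').trans hpu').symm
    _ = κ v := (hQ t (.inl rfl) q' hq' htq').trans hqv'
    _ = κ q := hqv.symm

end Separation

/-! ### Sums modulo a prime -/

section Spread

open scoped Pointwise

variable {V G : Type*} [DecidableEq V] [Group G] [MulAction G V] {p : ℕ} [Fact p.Prime]

theorem sum_smul_finset {M : Type*} [AddCommMonoid M] (g : G) (S : Finset V) (d : V → M) :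
    ∑ b ∈ g • S, d b = ∑ b ∈ S, d (g • b) := by
  rw [Finset.smul_finset_def, Finset.sum_image (MulAction.injective g).injOn]

/-- The function which agrees with `d` on `D` and is constant off `D`, with the constant chosen
such that the sum over `S` vanishes if `S ⊄ D`. -/
def spread (D S : Finset V) (d : V → ZMod p) (b : V) : ZMod p :=
  if b ∈ D then d b else -(∑ c ∈ S ∩ D, d c) / (S \ D).card

theorem spread_of_mem {D S : Finset V} {d : V → ZMod p} {b : V} (hb : b ∈ D) :
    spread D S d b = d b := if_pos hb

theorem spread_of_notMem {D S : Finset V} {d : V → ZMod p} {b : V} (hb : b ∉ D) :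
    spread D S d b = -(∑ c ∈ S ∩ D, d c) / (S \ D).card := if_neg hb

theorem spread_zero (D S : Finset V) : spread D S (0 : V → ZMod p) = 0 :=
  funext fun b => by simp [spread]

theorem spread_add (D S : Finset V) (d d' : V → ZMod p) :
    spread D S (d + d') = spread D S d + spread D S d' := by
  funext b
  simp only [spread, Pi.add_apply, Finset.sum_add_distrib]
  split_ifs
  · rfl
  · ring

theorem spread_smul (g : G) (D S : Finset V) (d : V → ZMod p) (b : V) :
    spread (g • D) (g • S) d (g • b) = spread D S (fun c => d (g • c)) b := by
  simp only [spread, Finset.smul_mem_smul_finset_iff, ← Finset.smul_finset_inter,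
    ← Finset.smul_finset_sdiff, sum_smul_finset, Finset.card_smul_finset]

theorem sum_spread [Fintype V] (hp : Fintype.card V < p) {D S : Finset V} {d : V → ZMod p}
    (h : S ⊆ D → ∑ b ∈ S, d b = 0) : ∑ b ∈ S, spread D S d b = 0 := by
  by_cases hS : S ⊆ D
  · rw [← h hS]
    exact Finset.sum_congr rfl fun b hb => spread_of_mem (hS hb)
  · have hcard : ((S \ D).card : ZMod p) ≠ 0 := by
      rw [Ne, ZMod.natCast_eq_zero_iff]
      exact Nat.not_dvd_of_pos_of_lt (Finset.card_pos.2 (Finset.sdiff_nonempty.2 hS))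
        ((Finset.card_le_univ _).trans_lt hp)
    have hD : ∑ b ∈ S ∩ D, spread D S d b = ∑ b ∈ S ∩ D, d b :=
      Finset.sum_congr rfl fun b hb => spread_of_mem (Finset.mem_inter.1 hb).2
    have hDc : ∑ b ∈ S \ D, spread D S d b = -∑ b ∈ S ∩ D, d b := by
      rw [Finset.sum_congr rfl fun b hb => spread_of_notMem (Finset.mem_sdiff.1 hb).2,
        Finset.sum_const, nsmul_eq_mul, mul_div_cancel₀ _ hcard]
    rw [← Finset.sum_inter_add_sum_sdiff S D, hD, hDc, add_neg_cancel]

end Spread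

/-! ### Embeddings and partial automorphisms -/

namespace Str

variable {L : PermLanguage} {V W Y : Type*} {A : Str L V} {B : Str L W} {C : Str L Y}

theorem isEmbedding_smul (g : L.Γ) (A : Str L V) : A.IsEmbedding (g • A) g id where
  injective := Function.injective_id
  map_rel R x := by
    change _ ↔ x ∈ A.rel (L.onRel g⁻¹ (L.onRel g R))
    simp [PermLanguage.onRel]
  map_fn F x := by
    change _ = A.fn (L.onFn g⁻¹ (L.onFn g F)) x
    simp [PermLanguage.onFn]

/-- The vertex set of the substructure generated by a vertex. -/
def cl (A : Str L V) (x : V) : Set V :=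
  {y | ∀ S : Set V, A.IsClosed S → x ∈ S → y ∈ S}

theorem mem_cl_self (A : Str L V) (x : V) : x ∈ A.cl x := fun _ _ h => h

theorem isClosed_cl (A : Str L V) (x : V) : A.IsClosed (A.cl x) :=
  fun F y hy _ hz S hS hx => hS F y (hy S hS hx) hz

theorem IsClosed.cl_subset {S : Set V} (hS : A.IsClosed S) {x : V} (hx : x ∈ S) : A.cl x ⊆ S :=
  fun _ hy => hy S hS hx

theorem fn_subset_cl (A : Str L V) (F : L.Fn) (x : V) : A.fn F x ⊆ A.cl x :=
  A.isClosed_cl x F x (A.mem_cl_self x)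

theorem isClosed_univ (A : Str L V) : A.IsClosed Set.univ := fun _ _ _ => Set.subset_univ _

theorem isClosed_setOf_notMem_cl (A : Str L V) (x : V) : A.IsClosed {y | x ∉ A.cl y} :=
  fun F y hy _ hz hxz => hy ((A.isClosed_cl y).cl_subset (A.fn_subset_cl F y hz) hxz)

theorem IsHom.isEmbedding_of_symm {g : L.Γ} {e : V ≃ W} (he : A.IsHom B g e)
    (he' : B.IsHom A g⁻¹ e.symm) : A.IsEmbedding B g e where
  injective := e.injective
  map_rel R x := by
    refine ⟨he.map_rel R x, fun hx => ?_⟩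
    simpa [PermLanguage.onRel, ← Function.comp_assoc] using he'.map_rel _ _ hx
  map_fn F x := by
    refine (he.map_fn F x).antisymm ?_
    rw [← e.symm_image_subset]
    simpa [PermLanguage.onFn] using he'.map_fn (L.onFn g F) (e x)

namespace IsEmbedding

variable {g h : L.Γ} {e : V → W} {f : W → Y}

theorem comp (hf : B.IsEmbedding C g f) (he : A.IsEmbedding B h e) :
    A.IsEmbedding C (g * h) (f ∘ e) where
  injective := hf.injective.comp he.injective
  map_rel R x := (he.map_rel R x).trans (hf.map_rel _ _)
  map_fn F x := by rw [Set.image_comp, he.map_fn, hf.map_fn]; rfl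

theorem of_comp (hf : B.IsEmbedding C h f) (hfe : A.IsEmbedding C g (f ∘ e)) :
    A.IsEmbedding B (h⁻¹ * g) e where
  injective := hfe.injective.of_comp
  map_rel R x := by
    rw [hf.map_rel, hfe.map_rel, ← Function.comp_assoc]
    simp [PermLanguage.onRel]
  map_fn F x := by
    apply hf.injective.image_injective
    rw [hf.map_fn, ← Set.image_comp, hfe.map_fn]
    simp [PermLanguage.onFn]

theorem symm {e : V ≃ W} (he : A.IsEmbedding B g e) : B.IsEmbedding A g⁻¹ e.symm := by
  have hid : B.IsEmbedding B 1 (e ∘ e.symm) := by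
    rw [e.self_comp_symm]
    exact ⟨Function.injective_id, fun _ _ => Iff.rfl, fun _ _ => Set.image_id _⟩
  simpa using he.of_comp hid

theorem isClosed_preimage (he : A.IsEmbedding B g e) {T : Set W} (hT : B.IsClosed T) :
    A.IsClosed (e ⁻¹' T) := fun F _ hx _ hy =>
  hT (L.onFn g F) _ hx (he.map_fn F _ ▸ Set.mem_image_of_mem e hy)

theorem isClosed_image (he : A.IsEmbedding B g e) {S : Set V} (hS : A.IsClosed S) :
    B.IsClosed (e '' S) := by
  rintro F _ ⟨x, hx, rfl⟩
  have hF : L.onFn g (L.onFn g⁻¹ F) = F := by simp [PermLanguage.onFn]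
  rw [← hF, ← he.map_fn]
  exact Set.image_mono (hS _ x hx)

theorem isClosed_range (he : A.IsEmbedding B g e) : B.IsClosed (Set.range e) :=
  Set.image_univ ▸ he.isClosed_image A.isClosed_univ

theorem image_cl (he : A.IsEmbedding B g e) (x : V) : e '' A.cl x = B.cl (e x) := by
  refine Set.Subset.antisymm (Set.image_subset_iff.2 ?_) ?_
  · exact (he.isClosed_preimage (B.isClosed_cl _)).cl_subset (B.mem_cl_self _)
  · exact (he.isClosed_image (A.isClosed_cl _)).cl_subset ⟨x, A.mem_cl_self _, rfl⟩

end IsEmbedding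

theorem IsClosed.isEmbedding_val {S : Set V} (hS : A.IsClosed S) :
    (A.induce S).IsEmbedding A 1 (Subtype.val : S → V) where
  injective := Subtype.val_injective
  map_rel _ _ := Iff.rfl
  map_fn F x := Set.Subset.antisymm (by rintro _ ⟨y, hy, rfl⟩; exact hy)
    fun y hy => ⟨⟨y, hS F x x.2 hy⟩, hy, rfl⟩

namespace PartialAut

theorem isEmbedding_toEquiv (f : A.PartialAut) :
    (A.induce f.dom).IsEmbedding A f.perm fun x => f.toEquiv x := by
  have h := f.cod_closed.isEmbedding_val.comp f.isEmbedding
  rwa [one_mul] at h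

theorem image_cl (f : A.PartialAut) (x : f.dom) :
    (fun y : f.dom => (f.toEquiv y : V)) '' (Subtype.val ⁻¹' A.cl x) = A.cl (f.toEquiv x) := by
  rw [← f.isEmbedding_toEquiv.image_cl, ← f.dom_closed.isEmbedding_val.image_cl,
    Set.preimage_image_eq _ Subtype.val_injective]

/-- The identity of a substructure. -/
def refl {S : Set V} (hS : A.IsClosed S) : A.PartialAut where
  perm := 1
  dom := S
  cod := S
  dom_closed := hS
  cod_closed := hS
  toEquiv := Equiv.refl S
  isEmbedding := ⟨Function.injective_id, fun _ _ => Iff.rfl, fun _ _ => Set.image_id _⟩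

/-- The inverse of a partial automorphism. -/
def symm (f : A.PartialAut) : A.PartialAut where
  perm := f.perm⁻¹
  dom := f.cod
  cod := f.dom
  dom_closed := f.cod_closed
  cod_closed := f.dom_closed
  toEquiv := f.toEquiv.symm
  isEmbedding := f.isEmbedding.symm

theorem isCoherentTriple_symm (f : A.PartialAut) :
    f.IsCoherentTriple f.symm (refl f.dom_closed) where
  dom_eq := rfl
  mid_eq := rfl
  cod_eq := rfl
  perm_eq := (inv_mul_cancel f.perm).symm
  map_eq x y z hzx hy := by
    rw [Subtype.ext hy]
    exact hzx.trans (congrArg Subtype.val (f.toEquiv.symm_apply_apply x).symm)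

theorem IsCoherentTriple.exists_equiv {f g h : A.PartialAut} (hc : f.IsCoherentTriple g h) :
    ∃ (s : f.dom ≃ g.dom) (t : f.dom ≃ h.dom),
      ∀ x, (s x : V) = f.toEquiv x ∧ (t x : V) = x ∧ (h.toEquiv (t x) : V) = g.toEquiv (s x) :=
  ⟨f.toEquiv.trans (Equiv.setCongr hc.mid_eq), Equiv.setCongr hc.dom_eq,
    fun x => ⟨rfl, rfl, hc.map_eq x _ _ rfl rfl⟩⟩

end PartialAut

theorem IsEmbedding.exists_partialAut {g g' : L.Γ} {e e' : V → W} (he : A.IsEmbedding B g e)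
    (he' : A.IsEmbedding B g' e') :
    ∃ f : A.PartialAut, f.perm = g'⁻¹ * g ∧ (∀ x y, e x = e' y → x ∈ f.dom) ∧
      ∀ x : f.dom, e x = e' (f.toEquiv x) := by
  have hS := he.isClosed_preimage he'.isClosed_range
  have hT := he'.isClosed_preimage he.isClosed_range
  choose r hr using fun x : e ⁻¹' Set.range e' => x.2
  let r' (x : e ⁻¹' Set.range e') : e' ⁻¹' Set.range e := ⟨r x, x, (hr x).symm⟩
  have her : e ∘ Subtype.val = (e' ∘ Subtype.val) ∘ r' := funext fun x => (hr x).symm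
  have hr' : (A.induce (e ⁻¹' Set.range e')).IsEmbedding (A.induce (e' ⁻¹' Set.range e))
      ((g' * 1)⁻¹ * (g * 1)) r' :=
    (he'.comp hT.isEmbedding_val).of_comp (her ▸ he.comp hS.isEmbedding_val)
  have hbij : Function.Bijective r' := by
    refine ⟨hr'.injective, fun ⟨y, x, hxy⟩ => ⟨⟨x, y, hxy.symm⟩, Subtype.ext ?_⟩⟩
    exact he'.injective ((hr _).trans hxy)
  refine ⟨⟨_, _, _, hS, hT, Equiv.ofBijective r' hbij, hr'⟩, by simp, ?_, fun x => (hr x).symm⟩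
  exact fun x y hxy => ⟨y, hxy.symm⟩

end Str

open Str

universe u₁ u₂ u₃ u₄ u₅ u₆

variable {L : PermLanguage.{u₁, u₂}} {V : Type u₃} {A : Str L V}

/-! ### Atlases -/

/-- A finite set of points covered by charts, that is, injective copies of the vertex set of `A`
with a language part, such that the partial isomorphisms between charts that are induced by the
partial automorphisms of `A` extend in a functorial way to permutations which preserve charts. -/
structure Atlas (A : Str L V) where
  Point : Type u₄
  Chart : Type u₅
  finite : Finite Point
  nonempty : Nonempty Chart
  perm : Chart → L.Γ
  map : Chart → V → Point
  injective : ∀ ε, Function.Injective (map ε)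
  covered : ∀ b, ∃ ε x, map ε x = b
  extend : Chart → Chart → A.PartialAut → Point → Point
  extend_map : ∀ ε₁ ε₂ (f : A.PartialAut) (x : f.dom),
    extend ε₁ ε₂ f (map ε₁ x) = map ε₂ (f.toEquiv x)
  extend_chart : ∀ ε₁ ε₂ f ε, ∃ ε', perm ε' = perm ε₂ * f.perm * (perm ε₁)⁻¹ * perm ε ∧
    ∀ x, extend ε₁ ε₂ f (map ε x) = map ε' x
  extend_refl : ∀ ε {S : Set V} (hS : A.IsClosed S) b, extend ε ε (PartialAut.refl hS) b = b
  extend_coherent : ∀ ε₁ ε₂ ε₃ {f g h : A.PartialAut}, f.IsCoherentTriple g h →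
    ∀ b, extend ε₁ ε₃ h b = extend ε₂ ε₃ g (extend ε₁ ε₂ f b)

namespace Atlas

attribute [instance] Atlas.finite Atlas.nonempty

variable {ℒ : Atlas.{u₁, u₂, u₃, u₄, u₅} A}

theorem extend_symm_extend (ε₁ ε₂ : ℒ.Chart) (f : A.PartialAut) (b : ℒ.Point) :
    ℒ.extend ε₂ ε₁ f.symm (ℒ.extend ε₁ ε₂ f b) = b := by
  rw [← ℒ.extend_coherent ε₁ ε₂ ε₁ f.isCoherentTriple_symm, extend_refl]

variable (ℒ) in
/-- The union of the structures `perm ε • A` transported along the charts `ε`. -/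
def toStr : Str L ℒ.Point where
  rel R := {b | ∃ ε, ∃ x ∈ (ℒ.perm ε • A).rel R, ℒ.map ε ∘ x = b}
  fn F b := {b' | ∃ ε x, ℒ.map ε x = b ∧ b' ∈ ℒ.map ε '' (ℒ.perm ε • A).fn F x}

theorem isHom_map (ε : ℒ.Chart) : A.IsHom ℒ.toStr (ℒ.perm ε) (ℒ.map ε) where
  map_rel R x hx := ⟨ε, x, ((isEmbedding_smul _ A).map_rel R x).1 hx, rfl⟩
  map_fn F x := by
    rintro _ ⟨y, hy, rfl⟩
    exact ⟨ε, x, rfl, y, (isEmbedding_smul _ A).map_fn F x ▸ ⟨y, hy, rfl⟩, rfl⟩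

theorem isHom_toStr {W : Type*} {B : Str L W} {g : L.Γ} {e : ℒ.Point → W}
    (he : ∀ ε, A.IsHom B (g * ℒ.perm ε) (e ∘ ℒ.map ε)) : ℒ.toStr.IsHom B g e where
  map_rel R _ := by
    rintro ⟨ε, x, hx, rfl⟩
    have := (he ε).map_rel (L.onRel (ℒ.perm ε)⁻¹ R) x hx
    simpa [PermLanguage.onRel, Function.comp_assoc] using this
  map_fn F _ := by
    rintro _ ⟨_, ⟨ε, x, rfl, y, hy, rfl⟩, rfl⟩
    simpa [PermLanguage.onFn] using (he ε).map_fn (L.onFn (ℒ.perm ε)⁻¹ F) x ⟨y, hy, rfl⟩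

theorem isHom_extend (ε₁ ε₂ : ℒ.Chart) (f : A.PartialAut) :
    ℒ.toStr.IsHom ℒ.toStr (ℒ.perm ε₂ * f.perm * (ℒ.perm ε₁)⁻¹) (ℒ.extend ε₁ ε₂ f) := by
  refine isHom_toStr fun ε => ?_
  obtain ⟨ε', hperm, hmap⟩ := ℒ.extend_chart ε₁ ε₂ f ε
  rw [← hperm, show ℒ.extend ε₁ ε₂ f ∘ ℒ.map ε = ℒ.map ε' from funext hmap]
  exact ℒ.isHom_map ε'

/-- The automorphism of the union structure which extends the partial isomorphism between the
charts `ε₁` and `ε₂` induced by `f`. -/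
def aut (ε₁ ε₂ : ℒ.Chart) (f : A.PartialAut) : ℒ.toStr.Aut where
  perm := ℒ.perm ε₂ * f.perm * (ℒ.perm ε₁)⁻¹
  toEquiv := ⟨ℒ.extend ε₁ ε₂ f, ℒ.extend ε₂ ε₁ f.symm, extend_symm_extend ε₁ ε₂ f,
    extend_symm_extend ε₂ ε₁ f.symm⟩
  isEmbedding := by
    refine IsHom.isEmbedding_of_symm (isHom_extend ε₁ ε₂ f) ?_
    have hperm : (ℒ.perm ε₂ * f.perm * (ℒ.perm ε₁)⁻¹)⁻¹ =
        ℒ.perm ε₁ * f.symm.perm * (ℒ.perm ε₂)⁻¹ := by simp [PartialAut.symm, mul_assoc]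
    rw [hperm]
    exact isHom_extend ε₂ ε₁ f.symm

variable (ℒ) in
/-- The charts agree on their overlaps: they are embeddings into the union structure. -/
def IsCompatible : Prop := ∀ ε, (ℒ.perm ε • A).IsEmbedding ℒ.toStr 1 (ℒ.map ε)

theorem isCompatible_of_overlap
    (hrel : ∀ (ε ε' : ℒ.Chart) {n : ℕ+} (R : L.Rel n) (x y : Fin (n : ℕ) → V),
      ℒ.map ε ∘ x = ℒ.map ε' ∘ y → x ∈ (ℒ.perm ε • A).rel R → y ∈ (ℒ.perm ε' • A).rel R)
    (hfn : ∀ (ε ε' : ℒ.Chart) (F : L.Fn) (x y : V), ℒ.map ε x = ℒ.map ε' y →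
      ℒ.map ε '' (ℒ.perm ε • A).fn F x ⊆ ℒ.map ε' '' (ℒ.perm ε' • A).fn F y) :
    ℒ.IsCompatible := fun ε =>
  { injective := ℒ.injective ε
    map_rel := fun R x => ⟨fun hx => ⟨ε, x, hx, rfl⟩,
      fun ⟨ε', y, hy, hyx⟩ => hrel ε' ε R y x hyx hy⟩
    map_fn := fun F x => Set.Subset.antisymm (fun _ hb => ⟨ε, x, rfl, hb⟩)
      fun _ ⟨ε', y, hyx, hb⟩ => hfn ε' ε F y x hyx hb }

theorem IsCompatible.isEmbedding_map (hℒ : ℒ.IsCompatible) (ε : ℒ.Chart) :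
    A.IsEmbedding ℒ.toStr (ℒ.perm ε) (ℒ.map ε) := by
  simpa using (hℒ ε).comp (isEmbedding_smul (ℒ.perm ε) A)

theorem IsCompatible.image_cl (hℒ : ℒ.IsCompatible) (ε : ℒ.Chart) (x : V) :
    ℒ.map ε '' A.cl x = ℒ.toStr.cl (ℒ.map ε x) :=
  (hℒ.isEmbedding_map ε).image_cl x

variable (ℒ) in
/-- Two points are adjacent if they lie in a common chart. -/
def Adj (b b' : ℒ.Point) : Prop := ∃ ε, b ∈ Set.range (ℒ.map ε) ∧ b' ∈ Set.range (ℒ.map ε)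

theorem Adj.symm {b b' : ℒ.Point} : ℒ.Adj b b' → ℒ.Adj b' b := fun ⟨ε, hb, hb'⟩ => ⟨ε, hb', hb⟩

theorem adj_self (b : ℒ.Point) : ℒ.Adj b b := by
  obtain ⟨ε, x, hx⟩ := ℒ.covered b
  exact ⟨ε, ⟨x, hx⟩, ⟨x, hx⟩⟩

variable (ℒ) in
/-- Sets of pairwise adjacent points. -/
def IsClique (K : Set ℒ.Point) : Prop := ∀ b ∈ K, ∀ b' ∈ K, ℒ.Adj b b'

variable (ℒ) in
/-- Sets of points which lie in a common chart. -/
def InChart (K : Set ℒ.Point) : Prop := ∃ ε, K ⊆ Set.range (ℒ.map ε)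

theorem IsCompatible.isClique_range (hℒ : ℒ.IsCompatible) {W : Type*} {D : Str L W}
    (hD : D.Irreducible) {g : L.Γ} {e : W → ℒ.Point} (he : D.IsEmbedding ℒ.toStr g e) :
    ℒ.IsClique (Set.range e) := by
  rintro _ ⟨d, rfl⟩ _ ⟨d', rfl⟩
  by_contra hdd
  have hchart (ε : ℒ.Chart) : ℒ.toStr.IsClosed (Set.range (ℒ.map ε)) :=
    (hℒ.isEmbedding_map ε).isClosed_range
  have hclosed (v : W) : D.IsClosed {w | e v ∉ ℒ.toStr.cl (e w)} :=
    he.isClosed_preimage (isClosed_setOf_notMem_cl _ _)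
  have hne (v : W) : {w | e v ∉ ℒ.toStr.cl (e w)} ≠ Set.univ := fun h =>
    (h ▸ Set.mem_univ v : v ∈ {w | e v ∉ ℒ.toStr.cl (e w)}) (mem_cl_self _ _)
  refine hD ⟨_, _, hne d, hne d', hclosed d, hclosed d', ?_, ?_⟩
  · refine Set.eq_univ_of_forall fun w => not_and_or.1 fun ⟨hd, hd'⟩ => hdd ?_
    obtain ⟨ε, y, hε⟩ := ℒ.covered (e w)
    exact ⟨ε, (hchart ε).cl_subset ⟨_, hε⟩ hd, (hchart ε).cl_subset ⟨_, hε⟩ hd'⟩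
  · rintro n R x hx ⟨⟨i, -, hi⟩, k, -, hk⟩
    obtain ⟨ε, y, -, hy⟩ := (he.map_rel R x).1 hx
    have hmem (i) : e (x i) ∈ Set.range (ℒ.map ε) := ⟨y i, congrFun hy i⟩
    exact hdd ⟨ε, (hchart ε).cl_subset (hmem k) (not_not.1 hk),
      (hchart ε).cl_subset (hmem i) (not_not.1 hi)⟩

end Atlas

/-! ### Labelled charts -/

namespace Atlas

/-- A chart of an atlas with an admissible labelling of its vertices. -/
structure LabelledChart (ℒ : Atlas.{u₁, u₂, u₃, u₄, u₅} A) {Label : Type u₆}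
    (IsAdmissible : ℒ.Chart → (V → Label) → Prop) where
  chart : ℒ.Chart
  label : V → Label
  admissible : IsAdmissible chart label

/-- The labelled point of the atlas given by a vertex of a labelled chart. -/
def LabelledChart.point {ℒ : Atlas.{u₁, u₂, u₃, u₄, u₅} A} {Label : Type u₆}
    {P : ℒ.Chart → (V → Label) → Prop} (q : ℒ.LabelledChart P) (x : V) : ℒ.Point × Label :=
  (ℒ.map q.chart x, q.label x)

/-- Finitely many labels and a notion of admissible labelling of the charts of an atlas, together
with a functorial lift of the permutations of the atlas to labelled points. -/
structure Scheme (ℒ : Atlas.{u₁, u₂, u₃, u₄, u₅} A) where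
  Label : Type u₆
  finite : Finite Label
  IsAdmissible : ℒ.Chart → (V → Label) → Prop
  nonempty : Nonempty (ℒ.LabelledChart IsAdmissible)
  relabel : ℒ.LabelledChart IsAdmissible → ℒ.LabelledChart IsAdmissible → A.PartialAut →
    ℒ.Point → Label → Label
  relabel_map : ∀ q₁ q₂ (f : A.PartialAut) (x : f.dom),
    relabel q₁ q₂ f (ℒ.map q₁.chart x) (q₁.label x) = q₂.label (f.toEquiv x)
  relabel_admissible : ∀ q₁ q₂ (f : A.PartialAut) (q : ℒ.LabelledChart IsAdmissible) (ε : ℒ.Chart),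
    ℒ.perm ε = ℒ.perm q₂.chart * f.perm * (ℒ.perm q₁.chart)⁻¹ * ℒ.perm q.chart →
    (∀ x, ℒ.extend q₁.chart q₂.chart f (ℒ.map q.chart x) = ℒ.map ε x) →
    IsAdmissible ε fun x => relabel q₁ q₂ f (ℒ.map q.chart x) (q.label x)
  relabel_refl : ∀ q {S : Set V} (hS : A.IsClosed S) b l,
    relabel q q (PartialAut.refl hS) b l = l
  relabel_coherent : ∀ q₁ q₂ q₃ {f g h : A.PartialAut}, f.IsCoherentTriple g h → ∀ b l,
    relabel q₁ q₃ h b l =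
      relabel q₂ q₃ g (ℒ.extend q₁.chart q₂.chart f b) (relabel q₁ q₂ f b l)

namespace Scheme

attribute [instance] Scheme.finite Scheme.nonempty

variable {ℒ : Atlas.{u₁, u₂, u₃, u₄, u₅} A} (𝒮 : Scheme.{u₁, u₂, u₃, u₄, u₅, u₆} ℒ)

/-- The lift to labelled points of the permutation of the atlas given by `f`. -/
def lift (q₁ q₂ : ℒ.LabelledChart 𝒮.IsAdmissible) (f : A.PartialAut)
    (p : ℒ.Point × 𝒮.Label) : ℒ.Point × 𝒮.Label :=
  (ℒ.extend q₁.chart q₂.chart f p.1, 𝒮.relabel q₁ q₂ f p.1 p.2)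

theorem lift_point (q₁ q₂ : ℒ.LabelledChart 𝒮.IsAdmissible) (f : A.PartialAut) (x : f.dom) :
    𝒮.lift q₁ q₂ f (q₁.point x) = q₂.point (f.toEquiv x) :=
  Prod.ext (ℒ.extend_map _ _ f x) (𝒮.relabel_map _ _ f x)

theorem exists_lift_point (q₁ q₂ : ℒ.LabelledChart 𝒮.IsAdmissible) (f : A.PartialAut)
    (q : ℒ.LabelledChart 𝒮.IsAdmissible) :
    ∃ q' : ℒ.LabelledChart 𝒮.IsAdmissible,
      ℒ.perm q'.chart = ℒ.perm q₂.chart * f.perm * (ℒ.perm q₁.chart)⁻¹ * ℒ.perm q.chart ∧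
        ∀ x, 𝒮.lift q₁ q₂ f (q.point x) = q'.point x := by
  obtain ⟨ε, hperm, hmap⟩ := ℒ.extend_chart q₁.chart q₂.chart f q.chart
  exact ⟨⟨ε, _, 𝒮.relabel_admissible q₁ q₂ f q ε hperm hmap⟩, hperm,
    fun x => Prod.ext (hmap x) rfl⟩

theorem lift_refl (q : ℒ.LabelledChart 𝒮.IsAdmissible) {S : Set V} (hS : A.IsClosed S) :
    𝒮.lift q q (PartialAut.refl hS) = id :=
  funext fun _ => Prod.ext (ℒ.extend_refl _ hS _) (𝒮.relabel_refl q hS _ _)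

theorem lift_coherent (q₁ q₂ q₃ : ℒ.LabelledChart 𝒮.IsAdmissible) {f g h : A.PartialAut}
    (hc : f.IsCoherentTriple g h) : 𝒮.lift q₁ q₃ h = 𝒮.lift q₂ q₃ g ∘ 𝒮.lift q₁ q₂ f :=
  funext fun _ => Prod.ext (ℒ.extend_coherent _ _ _ hc _) (𝒮.relabel_coherent q₁ q₂ q₃ hc _ _)

theorem lift_image_cl (q₁ q₂ : ℒ.LabelledChart 𝒮.IsAdmissible) (f : A.PartialAut) (x : f.dom) :
    𝒮.lift q₁ q₂ f '' (q₁.point '' A.cl x) = q₂.point '' A.cl (f.toEquiv x) := by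
  have hcl : A.cl x = Subtype.val '' (Subtype.val ⁻¹' A.cl x : Set f.dom) := by
    rw [Subtype.image_preimage_coe, Set.inter_eq_self_of_subset_right]
    exact f.dom_closed.cl_subset x.2
  rw [← f.image_cl, hcl, Set.preimage_image_eq _ Subtype.val_injective, Set.image_image,
    Set.image_image, Set.image_image]
  exact Set.image_congr fun y _ => 𝒮.lift_point q₁ q₂ f y

/-- The atlas of labelled points. A point also records the labels of the substructure generated by
it, so that the structure on the old points determines the structure on the new ones. -/
def step : Atlas.{u₁, u₂, u₃, max u₄ u₆, max u₃ u₅ u₆} A where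
  Point := {b : (ℒ.Point × 𝒮.Label) × Set (ℒ.Point × 𝒮.Label) //
    ∃ (q : ℒ.LabelledChart 𝒮.IsAdmissible) (x : V), (q.point x, q.point '' A.cl x) = b}
  Chart := ℒ.LabelledChart 𝒮.IsAdmissible
  finite := inferInstance
  nonempty := 𝒮.nonempty
  perm q := ℒ.perm q.chart
  map q x := ⟨(q.point x, q.point '' A.cl x), q, x, rfl⟩
  injective q _ _ h := ℒ.injective q.chart (congrArg (fun b => b.1.1.1) h)
  covered := fun ⟨_, q, x, hb⟩ => ⟨q, x, Subtype.ext hb⟩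
  extend q₁ q₂ f b := ⟨(𝒮.lift q₁ q₂ f b.1.1, 𝒮.lift q₁ q₂ f '' b.1.2), by
    obtain ⟨_, q, x, rfl⟩ := b
    obtain ⟨q', -, hq'⟩ := 𝒮.exists_lift_point q₁ q₂ f q
    exact ⟨q', x, by simp only [Set.image_image, hq']⟩⟩
  extend_map q₁ q₂ f x :=
    Subtype.ext (Prod.ext (𝒮.lift_point q₁ q₂ f x) (𝒮.lift_image_cl q₁ q₂ f x))
  extend_chart q₁ q₂ f q := by
    obtain ⟨q', hperm, hq'⟩ := 𝒮.exists_lift_point q₁ q₂ f q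
    exact ⟨q', hperm, fun x => Subtype.ext (by simp only [Set.image_image, hq'])⟩
  extend_refl q _ hS b := Subtype.ext (by simp [𝒮.lift_refl q hS])
  extend_coherent q₁ q₂ q₃ _ _ _ hc b :=
    Subtype.ext (by simp only [𝒮.lift_coherent q₁ q₂ q₃ hc, Set.image_image, Function.comp_apply])

variable {𝒮} {q q' : ℒ.LabelledChart 𝒮.IsAdmissible}

theorem point_eq_of_map_eq {x y : V} (h : 𝒮.step.map q x = 𝒮.step.map q' y) :
    q.point x = q'.point y :=
  congrArg (fun b => b.1.1) h

theorem image_cl_eq_of_map_eq {x y : V} (h : 𝒮.step.map q x = 𝒮.step.map q' y) :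
    q.point '' A.cl x = q'.point '' A.cl y :=
  congrArg (fun b => b.1.2) h

theorem image_cl_subset_of_point_eq
    (hfn : ∀ (F : L.Fn) (x y : V), q.point x = q'.point y →
      ℒ.map q.chart '' (ℒ.perm q.chart • A).fn F x ⊆
        ℒ.map q'.chart '' (ℒ.perm q'.chart • A).fn F y)
    {x y z w : V} (hxy : q.point '' A.cl x = q'.point '' A.cl y) (hz : z ∈ A.cl x)
    (hzw : q.point z = q'.point w) : q.point '' A.cl z ⊆ q'.point '' A.cl w := by
  have hclosed : A.IsClosed {u ∈ A.cl x | q.point u ∈ q'.point '' A.cl w} := by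
    rintro F u ⟨hu, u', hu', huu'⟩ v hv
    have hvx := A.isClosed_cl x F u hu hv
    obtain ⟨v', -, hvv'⟩ := hxy ▸ Set.mem_image_of_mem q.point hvx
    have hvF : v ∈ (ℒ.perm q.chart • A).fn (L.onFn (ℒ.perm q.chart) F) u :=
      (isEmbedding_smul _ A).map_fn F u ▸ ⟨v, hv, rfl⟩
    obtain ⟨v'', hv'', hvv''⟩ := hfn _ u u' huu'.symm ⟨v, hvF, rfl⟩
    obtain rfl : v' = v'' :=
      ℒ.injective _ ((congrArg Prod.fst hvv').trans hvv''.symm)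
    exact ⟨hvx, v', A.isClosed_cl w _ u' hu' hv'', hvv'⟩
  rintro _ ⟨u, hu, rfl⟩
  exact (hclosed.cl_subset ⟨hz, w, A.mem_cl_self w, hzw.symm⟩ hu).2

variable (𝒮)

theorem isCompatible_step
    (hrel : ∀ (q q' : ℒ.LabelledChart 𝒮.IsAdmissible) {n : ℕ+} (R : L.Rel n)
      (x y : Fin (n : ℕ) → V), q.point ∘ x = q'.point ∘ y →
        x ∈ (ℒ.perm q.chart • A).rel R → y ∈ (ℒ.perm q'.chart • A).rel R)
    (hfn : ∀ (q q' : ℒ.LabelledChart 𝒮.IsAdmissible) (F : L.Fn) (x y : V),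
      q.point x = q'.point y → ℒ.map q.chart '' (ℒ.perm q.chart • A).fn F x ⊆
        ℒ.map q'.chart '' (ℒ.perm q'.chart • A).fn F y) :
    𝒮.step.IsCompatible := by
  refine isCompatible_of_overlap (fun q q' n R x y hxy => hrel q q' R x y ?_) ?_
  · exact funext fun i => point_eq_of_map_eq (congrFun hxy i)
  · rintro q q' F x y hxy _ ⟨z, hz, rfl⟩
    have hcl := image_cl_eq_of_map_eq hxy
    have hzx : z ∈ A.cl x := A.fn_subset_cl _ x hz
    obtain ⟨w, hwy, hw⟩ := hcl ▸ Set.mem_image_of_mem q.point hzx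
    obtain ⟨w', hw', hzw'⟩ := hfn q q' F x y (point_eq_of_map_eq hxy) ⟨z, hz, rfl⟩
    obtain rfl : w' = w := ℒ.injective _ (hzw'.trans (congrArg Prod.fst hw).symm)
    refine ⟨w', hw', Subtype.ext (Prod.ext hw (Set.Subset.antisymm ?_ ?_))⟩
    · exact image_cl_subset_of_point_eq (hfn q' q) hcl.symm hwy hw
    · exact image_cl_subset_of_point_eq (hfn q q') hcl hzx hw.symm

theorem isCompatible_step_of_isCompatible (hℒ : ℒ.IsCompatible) : 𝒮.step.IsCompatible := by
  refine 𝒮.isCompatible_step (fun q q' n R x y hxy hx => ?_) fun q q' F x y hxy => ?_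
  · have hmap : ℒ.map q.chart ∘ x = ℒ.map q'.chart ∘ y := congrArg (Prod.fst ∘ ·) hxy
    rwa [(hℒ _).map_rel, ← hmap, ← (hℒ _).map_rel]
  · have hmap : ℒ.map q.chart x = ℒ.map q'.chart y := congrArg Prod.fst hxy
    rw [(hℒ _).map_fn, (hℒ _).map_fn, hmap]

end Scheme

end Atlas

/-! ### Compatible charts -/

section MarkAtlas

open scoped Pointwise

/-- The group acting on the structures with vertex set `V` by relabelling the language and moving
the vertices. -/
abbrev Motion (L : PermLanguage.{u₁, u₂}) (V : Type u₃) := L.Γ × Equiv.Perm V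

namespace Motion

instance : MulAction (Motion L V) V := MulAction.compHom V (MonoidHom.snd L.Γ (Equiv.Perm V))

instance : MulAction (Motion L V) (Str L V) where
  smul g A :=
    { rel := fun R => {x | (fun i => g⁻¹ • x i) ∈ (g.1 • A).rel R}
      fn := fun F x => {y | g⁻¹ • y ∈ (g.1 • A).fn F (g⁻¹ • x)} }
  one_smul _ := rfl
  mul_smul _ _ _ := rfl

theorem isEmbedding_smul_fst (g : Motion L V) (A : Str L V) :
    (g.1 • A).IsEmbedding (g • A) 1 (g • ·) where
  injective := MulAction.injective g
  map_rel R x := by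
    change _ ↔ (fun i => g⁻¹ • g • x i) ∈ (g.1 • A).rel R
    simp only [inv_smul_smul]
  map_fn F x := by
    change _ = {y | g⁻¹ • y ∈ (g.1 • A).fn F (g⁻¹ • g • x)}
    rw [inv_smul_smul]
    exact (Set.preimage_smul_inv g _).symm

theorem isEmbedding_smul (g : Motion L V) (A : Str L V) :
    A.IsEmbedding (g • A) g.1 (g • ·) := by
  simpa using (isEmbedding_smul_fst g A).comp (Str.isEmbedding_smul g.1 A)

theorem finite_orbit [Finite V] {A : Str L V} (h : (MulAction.orbit L.Γ A).Finite) :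
    Finite (MulAction.orbit (Motion L V) A) := by
  have : (⋃ σ : Equiv.Perm V, (fun B : Str L V => ((1, σ) : Motion L V) • B) ''
      MulAction.orbit L.Γ A).Finite := Set.finite_iUnion fun σ => h.image _
  refine (this.subset ?_).to_subtype
  rintro _ ⟨g, rfl⟩
  exact Set.mem_iUnion.2 ⟨g.2, g.1 • A, ⟨g.1, rfl⟩, rfl⟩

end Motion

namespace Str

/-- The structures `A` and `B` have the same relations and functions on `S`. -/
structure AgreeOn (S : Set V) (A B : Str L V) : Prop where
  rel : ∀ {n : ℕ+} (R : L.Rel n) (x : Fin (n : ℕ) → V), (∀ i, x i ∈ S) →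
    (x ∈ A.rel R ↔ x ∈ B.rel R)
  fn : ∀ (F : L.Fn), ∀ x ∈ S, A.fn F x = B.fn F x

namespace AgreeOn

variable {S T : Set V} {B C : Str L V}

theorem empty (A B : Str L V) : AgreeOn ∅ A B where
  rel {n} _ _ hx := (hx ⟨0, n.2⟩).elim
  fn _ _ hx := hx.elim

theorem rfl : AgreeOn S A A := ⟨fun _ _ _ => Iff.rfl, fun _ _ _ => Eq.refl _⟩

theorem symm (h : AgreeOn S A B) : AgreeOn S B A :=
  ⟨fun R x hx => (h.rel R x hx).symm, fun F x hx => (h.fn F x hx).symm⟩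

theorem trans (h : AgreeOn S A B) (h' : AgreeOn S B C) : AgreeOn S A C :=
  ⟨fun R x hx => (h.rel R x hx).trans (h'.rel R x hx),
    fun F x hx => (h.fn F x hx).trans (h'.fn F x hx)⟩

theorem mono (hST : S ⊆ T) (h : AgreeOn T A B) : AgreeOn S A B :=
  ⟨fun R x hx => h.rel R x fun i => hST (hx i), fun F x hx => h.fn F x (hST hx)⟩

theorem smul (g : Motion L V) (h : AgreeOn S A B) : AgreeOn (g • S) (g • A) (g • B) where
  rel R x hx := h.rel _ _ fun i => Set.mem_smul_set_iff_inv_smul_mem.1 (hx i)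
  fn F x hx := by
    ext y
    change g⁻¹ • y ∈ A.fn _ _ ↔ g⁻¹ • y ∈ B.fn _ _
    rw [h.fn _ _ (Set.mem_smul_set_iff_inv_smul_mem.1 hx)]

theorem smul_iff (g : Motion L V) : AgreeOn (g • S) (g • A) (g • B) ↔ AgreeOn S A B :=
  ⟨fun h => by simpa only [inv_smul_smul] using h.smul g⁻¹, smul g⟩

end AgreeOn

theorem PartialAut.agreeOn_smul {A : Str L V} (f : A.PartialAut) {g : Motion L V}
    (hperm : g.1 = f.perm) (hg : ∀ x : f.dom, g • (x : V) = f.toEquiv x) :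
    AgreeOn (g • f.dom) (g • A) A where
  rel R x hx := by
    choose y hy hyx using fun i => Set.mem_smul_set.1 (hx i)
    obtain ⟨R, rfl⟩ : ∃ R', L.onRel f.perm R' = R :=
      ⟨L.onRel f.perm⁻¹ R, by simp [PermLanguage.onRel]⟩
    obtain rfl : (fun i => g • y i) = x := funext hyx
    have hgf : (fun i => g • y i) = _ := funext fun i => hg ⟨y i, hy i⟩
    rw [← hperm]
    refine ((g.isEmbedding_smul A).map_rel R y).symm.trans ?_
    rw [hperm, hgf]
    exact f.isEmbedding_toEquiv.map_rel R fun i => ⟨y i, hy i⟩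
  fn F x hx := by
    obtain ⟨y, hy, rfl⟩ := hx
    obtain ⟨F, rfl⟩ : ∃ F', L.onFn f.perm F' = F :=
      ⟨L.onFn f.perm⁻¹ F, by simp [PermLanguage.onFn]⟩
    have himage := f.isEmbedding_toEquiv.map_fn F ⟨y, hy⟩
    simp only [← hg] at himage
    rw [← himage, ← hperm, ← (g.isEmbedding_smul A).map_fn]
    ext z
    exact ⟨fun ⟨w, hw, hwz⟩ => ⟨⟨w, f.dom_closed F y hy hw⟩, hw, hwz⟩,
      fun ⟨w, hw, hwz⟩ => ⟨w, hw, hwz⟩⟩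

end Str

theorem smul_eq_smul_iff_smul_toEquiv (ε₁ ε₂ : Motion L V) (f : A.PartialAut) (x y : f.dom) :
    ε₁ • (x : V) = ε₁ • (y : V) ↔ ε₂ • (f.toEquiv x : V) = ε₂ • (f.toEquiv y : V) := by
  rw [smul_left_cancel_iff, smul_left_cancel_iff, ← Subtype.ext_iff, ← Subtype.ext_iff,
    f.toEquiv.apply_eq_iff_eq]

section Transport

variable [LinearOrder V] [Finite V]

/-- The canonical motion which extends the partial isomorphism `ε₂ ∘ f ∘ ε₁⁻¹`. -/
noncomputable def transport (ε₁ ε₂ : Motion L V) (f : A.PartialAut) : Motion L V :=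
  (ε₂.1 * f.perm * ε₁.1⁻¹,
    canonicalPerm (fun x : f.dom => ε₁ • (x : V)) fun x => ε₂ • (f.toEquiv x : V))

theorem transport_smul (ε₁ ε₂ : Motion L V) (f : A.PartialAut) (x : f.dom) :
    transport ε₁ ε₂ f • ε₁ • (x : V) = ε₂ • (f.toEquiv x : V) :=
  (isCanonicalExtension_canonicalPerm (smul_eq_smul_iff_smul_toEquiv ε₁ ε₂ f)).apply_eq x

theorem transport_refl (ε : Motion L V) {S : Set V} (hS : A.IsClosed S) :
    transport ε ε (PartialAut.refl hS) = 1 :=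
  Prod.ext (by simp [transport, PartialAut.refl]) (canonicalPerm_self _)

theorem transport_coherent (ε₁ ε₂ ε₃ : Motion L V) {f g h : A.PartialAut}
    (hc : f.IsCoherentTriple g h) :
    transport ε₁ ε₃ h = transport ε₂ ε₃ g * transport ε₁ ε₂ f := by
  obtain ⟨s, t, hst⟩ := hc.exists_equiv
  refine Prod.ext (by simp [transport, hc.perm_eq, mul_assoc]) ?_
  have hf := canonicalPerm_mul (smul_eq_smul_iff_smul_toEquiv ε₁ ε₂ f)
    (c := fun x => ε₃ • (g.toEquiv (s x) : V)) fun x y => by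
      rw [← (hst x).1, ← (hst y).1]
      exact smul_eq_smul_iff_smul_toEquiv ε₂ ε₃ g (s x) (s y)
  have hg := canonicalPerm_comp (fun x : g.dom => ε₂ • (x : V))
    (fun x => ε₃ • (g.toEquiv x : V)) s.surjective
  have hh := canonicalPerm_comp (fun x : h.dom => ε₁ • (x : V))
    (fun x => ε₃ • (h.toEquiv x : V)) t.surjective
  simp only [Function.comp_def, hst] at hg hh
  exact hh.symm.trans (hf.symm.trans (congrArg (· * _) hg))

variable (A) in
/-- The atlas of all bijective charts from the vertex set of `A` to itself. -/
noncomputable abbrev permAtlas : Atlas.{u₁, u₂, u₃, u₃, max u₁ u₂ u₃} A where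
  Point := V
  Chart := Motion L V
  finite := inferInstance
  nonempty := inferInstance
  perm ε := ε.1
  map ε x := ε • x
  injective := MulAction.injective
  covered b := ⟨1, b, one_smul _ b⟩
  extend ε₁ ε₂ f b := transport ε₁ ε₂ f • b
  extend_map := transport_smul
  extend_chart ε₁ ε₂ f ε := ⟨transport ε₁ ε₂ f * ε, rfl, fun x => (mul_smul _ ε x).symm⟩
  extend_refl ε _ hS b := by rw [transport_refl, one_smul]
  extend_coherent ε₁ ε₂ ε₃ _ _ _ hc b := by rw [transport_coherent ε₁ ε₂ ε₃ hc, mul_smul]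

end Transport

variable (A) in
/-- A set of points and a structure in the orbit of `A`. -/
abbrev Mark := Finset V × MulAction.orbit (Motion L V) A

section Marks

open Classical in
/-- The labels of the points of `S` sum up to the indicator of the property that the structure of
the chart differs from `θ` on `S`. -/
def IsMarking (A : Str L V) (p : ℕ) (ε : Motion L V) (l : V → Mark A → ZMod p) : Prop :=
  ∀ i : Mark A, ∑ b ∈ i.1, l (ε⁻¹ • b) i = if AgreeOn i.1 (ε • A) i.2 then 0 else 1

theorem exists_isMarking (A : Str L V) (p : ℕ) (ε : Motion L V) : ∃ l, IsMarking A p ε l := by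
  classical
  have (i : Mark A) : ∃ l : V → ZMod p,
      ∑ b ∈ i.1, l (ε⁻¹ • b) = if AgreeOn i.1 (ε • A) i.2 then 0 else 1 := by
    obtain hi | ⟨b, hb⟩ := i.1.eq_empty_or_nonempty
    · exact ⟨0, by simp [hi, AgreeOn.empty]⟩
    · refine ⟨fun x => if ε • x = b then if AgreeOn i.1 (ε • A) i.2 then 0 else 1 else 0, ?_⟩
      simp [hb]
  choose l hl using this
  exact ⟨fun x i => l i x, hl⟩

theorem agreeOn_inv_smul_iff [DecidableEq V] (g : Motion L V) (i : Mark A) (B : Str L V) :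
    AgreeOn (g⁻¹ • i.1 : Finset V) B (g⁻¹ • i.2 : MulAction.orbit (Motion L V) A) ↔
      AgreeOn i.1 (g • B) i.2 := by
  rw [← AgreeOn.smul_iff g, Finset.coe_smul_finset, MulAction.orbit.coe_smul, smul_inv_smul,
    smul_inv_smul]

variable [LinearOrder V] [Finite V] {p : ℕ}

theorem agreeOn_transport (ε₁ ε₂ : Motion L V) (f : A.PartialAut) :
    AgreeOn (transport ε₁ ε₂ f • ε₁ • f.dom) (transport ε₁ ε₂ f • ε₁ • A) (ε₂ • A) := by
  have h := (f.agreeOn_smul (g := ε₂⁻¹ * transport ε₁ ε₂ f * ε₁) (by simp [transport, mul_assoc])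
    fun x => by rw [mul_smul, mul_smul, transport_smul, inv_smul_smul]).smul ε₂
  simpa only [mul_smul, smul_inv_smul] using h

variable (A p) in
/-- A chart with a labelling of its vertices which determines its structure. -/
abbrev MarkedChart := (permAtlas A).LabelledChart (IsMarking A p)

namespace MarkedChart

/-- The chart as a motion. -/
abbrev motion (c : MarkedChart A p) : Motion L V := c.chart

/-- The labelling of a marked chart, as a function of the points. -/
def mark (c : MarkedChart A p) (b : V) (i : Mark A) : ZMod p := c.label (c.motion⁻¹ • b) i

theorem mark_smul (c : MarkedChart A p) (x : V) : c.mark (c.motion • x) = c.label x := by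
  funext i
  rw [mark, inv_smul_smul]

open Classical in
/-- The points of the chart which are vertices of the domain of `f`. -/
noncomputable def domain (c : MarkedChart A p) (f : A.PartialAut) : Finset V :=
  (Set.toFinite (c.motion • f.dom)).toFinset

theorem coe_domain (c : MarkedChart A p) (f : A.PartialAut) :
    (c.domain f : Set V) = c.motion • f.dom := Set.Finite.coe_toFinset _

open Classical in
theorem sum_mark (c : MarkedChart A p) (i : Mark A) :
    ∑ b ∈ i.1, c.mark b i = if AgreeOn i.1 (c.motion • A) i.2 then 0 else 1 := c.admissible i

/-- The canonical motion which extends the partial isomorphism `c₂ ∘ f ∘ c₁⁻¹`. -/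
noncomputable abbrev transport (c₁ c₂ : MarkedChart A p) (f : A.PartialAut) : Motion L V :=
  EPPA.transport c₁.motion c₂.motion f

theorem transport_coherent (c₁ c₂ c₃ : MarkedChart A p) {f g h : A.PartialAut}
    (hc : f.IsCoherentTriple g h) :
    c₁.transport c₃ h = c₂.transport c₃ g * c₁.transport c₂ f :=
  EPPA.transport_coherent _ _ _ hc

theorem smul_domain (c₁ c₂ : MarkedChart A p) {f g h : A.PartialAut}
    (hc : f.IsCoherentTriple g h) : c₁.transport c₂ f • c₁.domain f = c₂.domain g := by
  rw [← Finset.coe_inj, Finset.coe_smul_finset, coe_domain, coe_domain, ← hc.mid_eq]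
  refine Set.Subset.antisymm ?_ ?_
  · rintro _ ⟨_, ⟨x, hx, rfl⟩, rfl⟩
    exact ⟨f.toEquiv ⟨x, hx⟩, (f.toEquiv _).2, (transport_smul _ _ f ⟨x, hx⟩).symm⟩
  · rintro _ ⟨y, hy, rfl⟩
    refine ⟨_, ⟨f.toEquiv.symm ⟨y, hy⟩, Subtype.coe_prop _, rfl⟩, ?_⟩
    exact (transport_smul _ _ f _).trans (by rw [Equiv.apply_symm_apply])

theorem agreeOn_setOf_mark_eq [Nontrivial (ZMod p)] (c₁ c₂ : MarkedChart A p) :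
    AgreeOn {b | c₁.mark b = c₂.mark b} (c₁.motion • A) (c₂.motion • A) := by
  classical
  let S : Finset V := (Set.toFinite {b | c₁.mark b = c₂.mark b}).toFinset
  have hS : (S : Set V) = {b | c₁.mark b = c₂.mark b} := Set.Finite.coe_toFinset _
  let i : Mark A := (S, ⟨c₂.motion • A, c₂.motion, rfl⟩)
  have hsum : ∑ b ∈ S, c₁.mark b i = ∑ b ∈ S, c₂.mark b i :=
    Finset.sum_congr rfl fun b hb => congrFun (hS.subset hb) i
  have h₂ : ∑ b ∈ S, c₂.mark b i = 0 := (c₂.sum_mark i).trans (if_pos AgreeOn.rfl)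
  rw [← hS]
  by_contra hA
  exact one_ne_zero (((c₁.sum_mark i).trans (if_neg hA)).symm.trans (hsum.trans h₂))

theorem mark_eq_of_point_eq {c₁ c₂ : MarkedChart A p} {x y : V} (h : c₁.point x = c₂.point y) :
    c₁.motion • x = c₂.motion • y ∧ c₁.mark (c₁.motion • x) = c₂.mark (c₁.motion • x) := by
  have hmap : c₁.motion • x = c₂.motion • y := congrArg Prod.fst h
  refine ⟨hmap, ?_⟩
  rw [mark_smul, hmap, mark_smul]
  exact congrArg Prod.snd h

variable [Fact p.Prime]

/-- The correction of the labels for the partial isomorphism `c₂ ∘ f ∘ c₁⁻¹`. -/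
noncomputable def shift (c₁ c₂ : MarkedChart A p) (f : A.PartialAut) (i : Mark A) : V → ZMod p :=
  spread (c₁.domain f) ((c₁.transport c₂ f)⁻¹ • i.1) fun b =>
    c₂.mark (c₁.transport c₂ f • b) i - c₁.mark b ((c₁.transport c₂ f)⁻¹ • i)

theorem shift_refl (c : MarkedChart A p) {S : Set V} (hS : A.IsClosed S) (i : Mark A) :
    c.shift c (PartialAut.refl hS) i = 0 := by
  simp only [shift, transport, transport_refl, inv_one, one_smul, sub_self]
  exact spread_zero _ _

theorem shift_coherent (c₁ c₂ c₃ : MarkedChart A p) {f g h : A.PartialAut}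
    (hc : f.IsCoherentTriple g h) (i : Mark A) (b : V) :
    c₁.shift c₃ h i b = c₁.shift c₂ f ((c₂.transport c₃ g)⁻¹ • i) b +
      c₂.shift c₃ g i (c₁.transport c₂ f • b) := by
  have hdom : c₁.domain h = c₁.domain f :=
    Finset.coe_injective (by rw [coe_domain, coe_domain, hc.dom_eq])
  have hset : (c₂.transport c₃ g)⁻¹ • i.1 =
      c₁.transport c₂ f • (c₁.transport c₂ f)⁻¹ • (c₂.transport c₃ g)⁻¹ • i.1 :=
    (smul_inv_smul _ _).symm
  simp only [shift]
  rw [← c₁.smul_domain c₂ hc, hset, spread_smul, transport_coherent c₁ c₂ c₃ hc, mul_inv_rev,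
    mul_smul, hdom, Prod.smul_fst, ← Pi.add_apply, ← spread_add]
  congr 1
  funext b
  simp only [Pi.add_apply, mul_smul]
  ring

theorem sum_shift (hp : Nat.card V < p) (c₁ c₂ : MarkedChart A p) (f : A.PartialAut)
    (i : Mark A) : ∑ b ∈ (c₁.transport c₂ f)⁻¹ • i.1, c₁.shift c₂ f i b = 0 := by
  classical
  have := Fintype.ofFinite V
  refine sum_spread (Nat.card_eq_fintype_card (α := V) ▸ hp) fun hsub => ?_
  rw [← Finset.coe_subset, Finset.coe_smul_finset, coe_domain,
    Set.smul_set_subset_iff_subset_inv_smul_set, inv_inv] at hsub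
  have hagree : AgreeOn ((c₁.transport c₂ f)⁻¹ • i.1 : Finset V) (c₁.motion • A)
      ((c₁.transport c₂ f)⁻¹ • i.2 : MulAction.orbit _ A) ↔ AgreeOn i.1 (c₂.motion • A) i.2 := by
    have h := (agreeOn_transport c₁.motion c₂.motion f).mono hsub
    rw [agreeOn_inv_smul_iff]
    exact ⟨h.symm.trans, h.trans⟩
  rw [Finset.sum_sub_distrib, sum_smul_finset]
  simp only [smul_inv_smul]
  rw [sum_mark, sub_eq_zero, ← if_congr hagree rfl rfl]
  exact (c₁.sum_mark ((c₁.transport c₂ f)⁻¹ • i)).symm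

open Classical in
theorem sum_relabel (hp : Nat.card V < p) (c₁ c₂ c : MarkedChart A p) (f : A.PartialAut)
    (i : Mark A) :
    ∑ b ∈ (c₁.transport c₂ f)⁻¹ • i.1,
      (c.mark b ((c₁.transport c₂ f)⁻¹ • i) + c₁.shift c₂ f i b) =
        if AgreeOn i.1 ((c₁.transport c₂ f * c.motion) • A) i.2 then 0 else 1 := by
  rw [Finset.sum_add_distrib, c₁.sum_shift hp c₂ f i, add_zero, mul_smul,
    ← if_congr (agreeOn_inv_smul_iff _ i _) rfl rfl]
  exact c.sum_mark _

end MarkedChart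

/-- The labelling scheme which makes the structure of a chart a function of the labels. -/
noncomputable def markScheme [Fact p.Prime] (horbit : (MulAction.orbit L.Γ A).Finite)
    (hp : Nat.card V < p) :
    Atlas.Scheme.{u₁, u₂, u₃, u₃, max u₁ u₂ u₃, max u₁ u₂ u₃} (permAtlas A) where
  Label := Mark A → ZMod p
  finite :=
    have := Motion.finite_orbit horbit
    have : NeZero p := ⟨(Fact.out : p.Prime).ne_zero⟩
    inferInstance
  IsAdmissible := IsMarking A p
  nonempty :=
    have ⟨l, hl⟩ := exists_isMarking A p 1
    ⟨⟨1, l, hl⟩⟩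
  relabel (c₁ c₂ : MarkedChart A p) f b l i :=
    l ((c₁.transport c₂ f)⁻¹ • i) + c₁.shift c₂ f i b
  relabel_map (c₁ c₂ : MarkedChart A p) f x := funext fun i => by
    have hx : c₁.motion • (x : V) ∈ c₁.domain f := by
      rw [← Finset.mem_coe, MarkedChart.coe_domain]
      exact ⟨x, x.2, rfl⟩
    rw [MarkedChart.shift, spread_of_mem hx, transport_smul, MarkedChart.mark_smul,
      MarkedChart.mark_smul, add_sub_cancel]
  relabel_admissible (c₁ c₂ : MarkedChart A p) f (c : MarkedChart A p) ε hperm hmap i := by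
    obtain rfl : c₁.transport c₂ f * c.motion = ε :=
      Prod.ext hperm.symm (Equiv.ext hmap)
    rw [← c₁.sum_relabel hp c₂ c f i, sum_smul_finset]
    refine Finset.sum_congr rfl fun b _ => ?_
    simp only [MarkedChart.mark, mul_inv_rev, mul_smul, smul_inv_smul]
  relabel_refl (c : MarkedChart A p) S hS b l := funext fun i => by
    rw [MarkedChart.shift_refl, MarkedChart.transport, transport_refl, inv_one, one_smul,
      Pi.zero_apply, add_zero]
  relabel_coherent (c₁ c₂ c₃ : MarkedChart A p) f g h hc b l := funext fun i => by
    rw [c₁.shift_coherent c₂ c₃ hc, c₁.transport_coherent c₂ c₃ hc, mul_inv_rev, mul_smul,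
      add_assoc]

theorem isCompatible_step_markScheme [Fact p.Prime] (horbit : (MulAction.orbit L.Γ A).Finite)
    (hp : Nat.card V < p) : (markScheme horbit hp).step.IsCompatible := by
  refine Atlas.Scheme.isCompatible_step _ ?_ ?_
  · intro (c : MarkedChart A p) (c' : MarkedChart A p) n R x y hxy hx
    have hpoint (i) := MarkedChart.mark_eq_of_point_eq (congrFun hxy i)
    have hmap : (c.motion • ·) ∘ x = (c'.motion • ·) ∘ y := funext fun i => (hpoint i).1
    rw [(Motion.isEmbedding_smul_fst c'.motion A).map_rel, ← hmap]
    refine ((c.agreeOn_setOf_mark_eq c').rel _ _ fun i => (hpoint i).2).1 ?_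
    exact ((Motion.isEmbedding_smul_fst c.motion A).map_rel R x).1 hx
  · intro (c : MarkedChart A p) (c' : MarkedChart A p) F x y hxy
    obtain ⟨hmap, hmark⟩ := MarkedChart.mark_eq_of_point_eq hxy
    refine ((Motion.isEmbedding_smul_fst c.motion A).map_fn F x).trans_subset ?_
    rw [(c.agreeOn_setOf_mark_eq c').fn _ _ hmark, hmap]
    exact ((Motion.isEmbedding_smul_fst c'.motion A).map_fn F y).symm.subset

end Marks

end MarkAtlas

namespace Atlas

/-- The atlas with the points renamed. -/
def reindex (ℒ : Atlas.{u₁, u₂, u₃, u₄, u₅} A) {P : Type u₆} (e : ℒ.Point ≃ P) :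
    Atlas.{u₁, u₂, u₃, u₆, u₅} A where
  Point := P
  Chart := ℒ.Chart
  finite := .of_equiv _ e
  nonempty := ℒ.nonempty
  perm := ℒ.perm
  map ε x := e (ℒ.map ε x)
  injective ε := e.injective.comp (ℒ.injective ε)
  covered b := by
    obtain ⟨ε, x, h⟩ := ℒ.covered (e.symm b)
    exact ⟨ε, x, e.symm_apply_eq.1 h.symm |>.symm⟩
  extend ε₁ ε₂ f b := e (ℒ.extend ε₁ ε₂ f (e.symm b))
  extend_map ε₁ ε₂ f x := by rw [e.symm_apply_apply, ℒ.extend_map]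
  extend_chart ε₁ ε₂ f ε := by
    simpa only [e.symm_apply_apply, e.apply_eq_iff_eq] using ℒ.extend_chart ε₁ ε₂ f ε
  extend_refl ε _ hS b := by rw [ℒ.extend_refl, e.apply_symm_apply]
  extend_coherent ε₁ ε₂ ε₃ _ _ _ hc b := by
    rw [ℒ.extend_coherent ε₁ ε₂ ε₃ hc, e.symm_apply_apply]

theorem IsCompatible.reindex {ℒ : Atlas.{u₁, u₂, u₃, u₄, u₅} A} (hℒ : ℒ.IsCompatible)
    {P : Type u₆} (e : ℒ.Point ≃ P) : (ℒ.reindex e).IsCompatible := by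
  refine isCompatible_of_overlap (fun (ε : ℒ.Chart) (ε' : ℒ.Chart) n R x y hxy hx => ?_)
    fun (ε : ℒ.Chart) (ε' : ℒ.Chart) F x y hxy => ?_
  · have hmap : ℒ.map ε ∘ x = ℒ.map ε' ∘ y :=
      funext fun i => e.injective (congrFun hxy i)
    change x ∈ (ℒ.perm ε • A).rel R at hx
    change y ∈ (ℒ.perm ε' • A).rel R
    rwa [(hℒ _).map_rel, ← hmap, ← (hℒ _).map_rel]
  · have hmap : ℒ.map ε x = ℒ.map ε' y := e.injective hxy
    change (e ∘ ℒ.map ε) '' (ℒ.perm ε • A).fn F x ⊆ (e ∘ ℒ.map ε') '' (ℒ.perm ε' • A).fn F y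
    rw [Set.image_comp, Set.image_comp, (hℒ _).map_fn, (hℒ _).map_fn, hmap]

end Atlas

theorem exists_isCompatible_atlas [Finite V] (horbit : (MulAction.orbit L.Γ A).Finite) :
    ∃ ℒ : Atlas.{u₁, u₂, u₃, 0, max u₁ u₂ u₃} A, ℒ.IsCompatible := by
  classical
  let := linearOrderOfSTO (WellOrderingRel (α := V))
  obtain ⟨p, hp, hprime⟩ := Nat.exists_infinite_primes (Nat.card V + 1)
  have := Fact.mk hprime
  exact ⟨_, (isCompatible_step_markScheme horbit hp).reindex (Finite.equivFin _)⟩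

/-! ### Cliques lie in charts -/

namespace Atlas

section Pattern

variable {ℒ : Atlas.{u₁, u₂, u₃, u₄, u₅} A} {q : ℕ}

/-- The colouring `l` of the vertices of the chart `ε` has the relation `g` as its relation of
having the same colour. -/
def Realizes (ε : ℒ.Chart) (l : V → WithBot (Fin q)) (g : ℒ.Point → ℒ.Point → Prop) : Prop :=
  ∀ x y, SameColour l x y ↔ g (ℒ.map ε x) (ℒ.map ε y)

variable (ℒ q) in
/-- The relations on the points which, on every chart, are the relation of having the same colour
in some partial colouring with `q` colours. -/
def Pattern := {g : ℒ.Point → ℒ.Point → Prop // ∀ ε, ∃ l : V → WithBot (Fin q), Realizes ε l g}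

instance : Finite (ℒ.Pattern q) := Subtype.finite

namespace Pattern

/-- The preimage of a pattern under a permutation of the atlas. -/
def pull (ε₁ ε₂ : ℒ.Chart) (f : A.PartialAut) (g : ℒ.Pattern q) : ℒ.Pattern q :=
  ⟨fun b b' => g.1 (ℒ.extend ε₁ ε₂ f b) (ℒ.extend ε₁ ε₂ f b'), fun ε => by
    obtain ⟨ε', -, hmap⟩ := ℒ.extend_chart ε₁ ε₂ f ε
    obtain ⟨l, hl⟩ := g.2 ε'
    exact ⟨l, fun x y => by simpa only [hmap] using hl x y⟩⟩

theorem pull_refl (ε : ℒ.Chart) {S : Set V} (hS : A.IsClosed S) (g : ℒ.Pattern q) :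
    g.pull ε ε (PartialAut.refl hS) = g :=
  Subtype.ext (by simp only [pull, ℒ.extend_refl])

theorem pull_coherent (ε₁ ε₂ ε₃ : ℒ.Chart) {f g h : A.PartialAut} (hc : f.IsCoherentTriple g h)
    (k : ℒ.Pattern q) : k.pull ε₁ ε₃ h = (k.pull ε₂ ε₃ g).pull ε₁ ε₂ f :=
  Subtype.ext (by simp only [pull, ℒ.extend_coherent ε₁ ε₂ ε₃ hc])

end Pattern

/-- The labels of the vertices of the chart `ε` are families of colours which realize all
patterns. -/
def IsPatternLabelling (ε : ℒ.Chart) (l : V → ℒ.Pattern q → WithBot (Fin q)) : Prop :=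
  ∀ g : ℒ.Pattern q, Realizes ε (fun x => l x g) g.1

theorem exists_isPatternLabelling (ε : ℒ.Chart) :
    ∃ l : V → ℒ.Pattern q → WithBot (Fin q), IsPatternLabelling ε l := by
  choose l hl using fun g : ℒ.Pattern q => g.2 ε
  exact ⟨fun x g => l g x, hl⟩

variable (ℒ q) in
/-- A chart with a family of colourings which realizes all patterns with `q` colours. -/
abbrev PatternChart := ℒ.LabelledChart (IsPatternLabelling (q := q))

namespace PatternChart

theorem sameColour_label_pull_iff (c₁ c₂ : ℒ.PatternChart q) (f : A.PartialAut)
    (g : ℒ.Pattern q) (x y : f.dom) :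
    SameColour (fun x : f.dom => c₁.label x (g.pull c₁.chart c₂.chart f)) x y ↔
      SameColour (fun x : f.dom => c₂.label (f.toEquiv x) g) x y := by
  have h := c₁.admissible (g.pull c₁.chart c₂.chart f) x y
  simp only [Pattern.pull, ℒ.extend_map] at h
  exact h.trans (c₂.admissible g (f.toEquiv x) (f.toEquiv y)).symm

/-- The permutation of the colours for the pattern `g` given by the partial isomorphism
`c₂ ∘ f ∘ c₁⁻¹`. -/
noncomputable def recolour (c₁ c₂ : ℒ.PatternChart q) (f : A.PartialAut) (g : ℒ.Pattern q) :
    Equiv.Perm (WithBot (Fin q)) :=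
  colourPerm (fun x : f.dom => c₁.label x (g.pull c₁.chart c₂.chart f))
    fun x => c₂.label (f.toEquiv x) g

theorem recolour_coherent (c₁ c₂ c₃ : ℒ.PatternChart q) {f g h : A.PartialAut}
    (hc : f.IsCoherentTriple g h) (k : ℒ.Pattern q) :
    c₁.recolour c₃ h k = c₂.recolour c₃ g k * c₁.recolour c₂ f (k.pull c₂.chart c₃.chart g) := by
  obtain ⟨s, t, hst⟩ := hc.exists_equiv
  have hf := colourPerm_mul
    (sameColour_label_pull_iff c₁ c₂ f (k.pull c₂.chart c₃.chart g))
    (c := fun x => c₃.label (g.toEquiv (s x)) k) fun x y => by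
      simp only [← (hst _).1]
      exact sameColour_label_pull_iff c₂ c₃ g k (s x) (s y)
  have hg := colourPerm_comp (fun x : g.dom => c₂.label x (k.pull c₂.chart c₃.chart g))
    (fun x => c₃.label (g.toEquiv x) k) s.surjective
  have hh := colourPerm_comp (fun x : h.dom => c₁.label x (k.pull c₁.chart c₃.chart h))
    (fun x => c₃.label (h.toEquiv x) k) t.surjective
  simp only [Function.comp_def, hst, k.pull_coherent c₁.chart c₂.chart c₃.chart hc] at hg hh
  rw [recolour, k.pull_coherent c₁.chart c₂.chart c₃.chart hc]
  exact hh.symm.trans (hf.symm.trans (congrArg (· * _) hg))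

end PatternChart

variable (ℒ q) in
/-- The labelling scheme which records the colours of a point for all patterns. -/
noncomputable def patternScheme : Scheme.{u₁, u₂, u₃, u₄, u₅, u₄} ℒ where
  Label := ℒ.Pattern q → WithBot (Fin q)
  finite := inferInstance
  IsAdmissible := IsPatternLabelling
  nonempty :=
    have ⟨l, hl⟩ := exists_isPatternLabelling (Classical.arbitrary ℒ.Chart)
    ⟨⟨_, l, hl⟩⟩
  relabel (c₁ c₂ : ℒ.PatternChart q) f _ l g :=
    c₁.recolour c₂ f g (l (g.pull c₁.chart c₂.chart f))
  relabel_map (c₁ c₂ : ℒ.PatternChart q) f x := funext fun g =>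
    colourPerm_apply (c₁.sameColour_label_pull_iff c₂ f g) x
  relabel_admissible (c₁ c₂ : ℒ.PatternChart q) f c ε _ hmap g x y := by
    refine (sameColour_perm_comp_iff (colourPerm_bot (c₁.sameColour_label_pull_iff c₂ f g))).trans
      ((c.admissible (g.pull c₁.chart c₂.chart f) x y).trans ?_)
    simp only [Pattern.pull, hmap]
  relabel_refl (c : ℒ.PatternChart q) _ hS _ l := funext fun g => by
    rw [PatternChart.recolour, g.pull_refl]
    exact congrArg (· (l g)) (colourPerm_self _)
  relabel_coherent (c₁ c₂ c₃ : ℒ.PatternChart q) _ _ _ hc _ l := funext fun k => by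
    rw [c₁.recolour_coherent c₂ c₃ hc, k.pull_coherent c₁.chart c₂.chart c₃.chart hc]
    rfl

variable (ℒ q) in
/-- The atlas of the points of `ℒ` labelled by the colours for all patterns with `q` colours. -/
noncomputable abbrev next : Atlas A := (ℒ.patternScheme q).step

/-- The old point underlying a labelled point. -/
abbrev proj (b : (ℒ.next q).Point) : ℒ.Point := b.1.1.1

/-- The colouring for the pattern `g` recorded by the labels. -/
def colour (g : ℒ.Pattern q) (b : (ℒ.next q).Point) : WithBot (Fin q) := b.1.1.2 g

variable {b b' : (ℒ.next q).Point}

theorem Adj.sameColour_iff (h : (ℒ.next q).Adj b b') (g : ℒ.Pattern q) :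
    SameColour (colour g) b b' ↔ g.1 (proj b) (proj b') := by
  obtain ⟨c, ⟨x, rfl⟩, y, rfl⟩ := h
  exact c.admissible g x y

theorem Adj.proj (h : (ℒ.next q).Adj b b') : ℒ.Adj (proj b) (proj b') := by
  obtain ⟨c, ⟨x, rfl⟩, y, rfl⟩ := h
  exact ⟨c.chart, ⟨x, rfl⟩, y, rfl⟩

theorem Adj.eq_of_proj_eq (h : (ℒ.next q).Adj b b') (hproj : Atlas.proj b = Atlas.proj b') :
    b = b' := by
  obtain ⟨c, ⟨x, rfl⟩, y, rfl⟩ := h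
  rw [ℒ.injective c.chart hproj]

variable {K : Set (ℒ.next q).Point}

theorem IsClique.image_proj (hK : (ℒ.next q).IsClique K) : ℒ.IsClique (Atlas.proj '' K) := by
  rintro _ ⟨b, hb, rfl⟩ _ ⟨b', hb', rfl⟩
  exact (hK b hb b' hb').proj

theorem IsClique.injOn_proj (hK : (ℒ.next q).IsClique K) : Set.InjOn Atlas.proj K :=
  fun b hb b' hb' => (hK b hb b' hb').eq_of_proj_eq

theorem Scheme.map_eq_of_label_eq (hℒ : ℒ.IsCompatible) (𝒮 : Scheme.{u₁, u₂, u₃, u₄, u₅, u₄} ℒ)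
    {c c' : ℒ.LabelledChart 𝒮.IsAdmissible} {x y : V} (hxy : ℒ.map c.chart x = ℒ.map c'.chart y)
    (hlabel : ∀ z, ∀ w ∈ A.cl y, ℒ.map c.chart z = ℒ.map c'.chart w → c.label z = c'.label w) :
    𝒮.step.map c x = 𝒮.step.map c' y := by
  have hcl : ℒ.map c.chart '' A.cl x = ℒ.map c'.chart '' A.cl y := by
    rw [hℒ.image_cl, hℒ.image_cl, hxy]
  have hpoint {z w : V} (hw : w ∈ A.cl y) (h : ℒ.map c.chart z = ℒ.map c'.chart w) :
      c.point z = c'.point w := Prod.ext h (hlabel z w hw h)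
  refine Subtype.ext (Prod.ext (hpoint (A.mem_cl_self y) hxy) (Set.Subset.antisymm ?_ ?_))
  · rintro _ ⟨z, hz, rfl⟩
    obtain ⟨w, hw, hwz⟩ := hcl.subset ⟨z, hz, rfl⟩
    exact ⟨w, hw, (hpoint hw hwz.symm).symm⟩
  · rintro _ ⟨w, hw, rfl⟩
    obtain ⟨z, hz, hzw⟩ := hcl.superset ⟨w, hw, rfl⟩
    exact ⟨z, hz, hpoint hw hzw⟩

theorem exists_isPatternLabelling_extending (ε : ℒ.Chart)
    {ρ : Set (V × (ℒ.Pattern q → WithBot (Fin q)))}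
    (hρ : ∀ p ∈ ρ, ∀ p' ∈ ρ, ∃ c : ℒ.PatternChart q,
      (ℒ.map ε p.1, p.2) ∈ Set.range c.point ∧ (ℒ.map ε p'.1, p'.2) ∈ Set.range c.point) :
    ∃ l : V → ℒ.Pattern q → WithBot (Fin q), IsPatternLabelling ε l ∧ ∀ p ∈ ρ, l p.1 = p.2 := by
  obtain ⟨l, hl⟩ := exists_isPatternLabelling (q := q) ε
  have hsame (g : ℒ.Pattern q) (p p' : ρ) :
      SameColour (fun p : ρ => l p.1.1 g) p p' ↔ SameColour (fun p : ρ => p.1.2 g) p p' := by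
    obtain ⟨c, ⟨x, hx⟩, x', hx'⟩ := hρ p p.2 p' p'.2
    have hmap : ℒ.map c.chart x = ℒ.map ε p.1.1 := congrArg Prod.fst hx
    have hmap' : ℒ.map c.chart x' = ℒ.map ε p'.1.1 := congrArg Prod.fst hx'
    have hlabel : c.label x = p.1.2 := congrArg Prod.snd hx
    have hlabel' : c.label x' = p'.1.2 := congrArg Prod.snd hx'
    refine (hl g p.1.1 p'.1.1).trans ?_
    rw [← hmap, ← hmap', ← c.admissible g x x']
    simp only [SameColour, hlabel, hlabel']
  refine ⟨fun x g => colourPerm (fun p : ρ => l p.1.1 g) (fun p => p.1.2 g) (l x g),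
    fun g x y => ?_, fun p hp => funext fun g => colourPerm_apply (hsame g) ⟨p, hp⟩⟩
  exact (sameColour_perm_comp_iff (colourPerm_bot (hsame g))).trans (hl g x y)

theorem IsClique.inChart_of_image_proj (hℒ : ℒ.IsCompatible) (hK : (ℒ.next q).IsClique K)
    (h : ℒ.InChart (Atlas.proj '' K)) : (ℒ.next q).InChart K := by
  obtain ⟨ε, hε⟩ := h
  obtain ⟨l, hl, hlK⟩ := exists_isPatternLabelling_extending (q := q) ε
    (ρ := {p | ∃ b ∈ K, (ℒ.map ε p.1, p.2) ∈ b.1.2}) (by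
      rintro p ⟨b, hb, hp⟩ p' ⟨b', hb', hp'⟩
      obtain ⟨c, ⟨x, rfl⟩, y, rfl⟩ := hK b hb b' hb'
      exact ⟨c, Set.image_subset_range _ _ hp, Set.image_subset_range _ _ hp'⟩)
  refine ⟨⟨ε, l, hl⟩, fun b hb => ?_⟩
  obtain ⟨x, hx⟩ := hε ⟨b, hb, rfl⟩
  obtain ⟨c, y, rfl⟩ := (ℒ.next q).covered b
  refine ⟨x, Scheme.map_eq_of_label_eq hℒ _ hx fun z w hw hzw => ?_⟩
  exact hlK (z, c.label w) ⟨_, hb, w, hw, Prod.ext hzw.symm rfl⟩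

theorem exists_realizes_eq {K : Set ℒ.Point} (hK : ¬ℒ.InChart K) (hq : K.ncard ≤ q + 1)
    (ε : ℒ.Chart) : ∃ l : V → WithBot (Fin q), Realizes ε l fun b b' => b ∈ K ∧ b = b' := by
  classical
  have hlt : (K ∩ Set.range (ℒ.map ε)).ncard < q + 1 := hq.trans_lt' <|
    Set.ncard_lt_ncard ⟨Set.inter_subset_left, fun h => hK ⟨ε, fun b hb => (h hb).2⟩⟩
  obtain ⟨e⟩ : Nonempty (↥(K ∩ Set.range (ℒ.map ε)) ↪ Fin q) := by
    have := Fintype.ofFinite ↥(K ∩ Set.range (ℒ.map ε))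
    refine Function.Embedding.nonempty_of_card_le ?_
    rw [Fintype.card_fin, ← Nat.card_eq_fintype_card, Nat.card_coe_set_eq]
    exact Nat.lt_succ_iff.1 hlt
  refine ⟨fun x => if h : ℒ.map ε x ∈ K then e ⟨ℒ.map ε x, h, x, rfl⟩ else ⊥, fun x y => ?_⟩
  by_cases hx : ℒ.map ε x ∈ K
  · by_cases hy : ℒ.map ε y ∈ K
    · simp only [SameColour, hx, hy, dif_pos, ne_eq, WithBot.coe_ne_bot, not_false_iff, true_and,
        WithBot.coe_inj, e.injective.eq_iff]
      exact Subtype.mk_eq_mk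
    · simp [SameColour, hx, hy, ne_of_mem_of_not_mem hx hy]
  · simp [SameColour, hx]

theorem IsClique.inChart_of_ncard_eq (hℒ : ℒ.IsCompatible) (hK : (ℒ.next q).IsClique K)
    (hq : K.ncard = q + 1) : (ℒ.next q).InChart K := by
  refine hK.inChart_of_image_proj hℒ ?_
  by_contra hbad
  have hcard : (Atlas.proj '' K).ncard ≤ q + 1 := by rw [hK.injOn_proj.ncard_image, hq]
  let g : ℒ.Pattern q := ⟨_, exists_realizes_eq hbad hcard⟩
  have hcolour {b b'} (hb : b ∈ K) (hb' : b' ∈ K) : SameColour (colour g) b b' ↔ b = b' := by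
    refine ((hK b hb b' hb').sameColour_iff g).trans ?_
    exact (and_iff_right ⟨b, hb, rfl⟩).trans (hK.injOn_proj.eq_iff hb hb')
  have hbot {b} (hb : b ∈ K) : colour g b ≠ ⊥ := ((hcolour hb hb).2 rfl).1
  have hinj : Set.InjOn (colour g) K := fun b hb b' hb' h => (hcolour hb hb').1 ⟨hbot hb, h⟩
  have hsub : colour g '' K ⊆ {⊥}ᶜ := Set.image_subset_iff.2 fun b hb => hbot hb
  have hle := Set.ncard_le_ncard hsub
  rw [hinj.ncard_image, hq, Set.ncard_compl, Set.ncard_singleton] at hle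
  simp [WithBot, Nat.card_eq_fintype_card] at hle

end Pattern

theorem exists_inChart_of_ncard_le {ℒ : Atlas.{u₁, u₂, u₃, 0, max u₁ u₂ u₃} A}
    (hℒ : ℒ.IsCompatible) (m : ℕ) : ∃ ℒ' : Atlas.{u₁, u₂, u₃, 0, max u₁ u₂ u₃} A,
      ℒ'.IsCompatible ∧ ∀ K, ℒ'.IsClique K → K.ncard ≤ m → ℒ'.InChart K := by
  induction m with
  | zero =>
    refine ⟨ℒ, hℒ, fun K _ hK => ⟨Classical.arbitrary _, ?_⟩⟩
    rw [(Set.ncard_eq_zero (Set.toFinite K)).1 (Nat.le_zero.1 hK)]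
    exact Set.empty_subset _
  | succ m ih =>
    obtain ⟨ℒ', hℒ', hclique⟩ := ih
    refine ⟨ℒ'.next m, Scheme.isCompatible_step_of_isCompatible _ hℒ', fun K hK hm => ?_⟩
    obtain hm | hm := hm.lt_or_eq
    · refine hK.inChart_of_image_proj hℒ' (hclique _ hK.image_proj ?_)
      rw [hK.injOn_proj.ncard_image]
      exact Nat.lt_succ_iff.1 hm
    · exact hK.inChart_of_ncard_eq hℒ' hm

theorem exists_inChart_of_isClique [Finite V] {ℒ : Atlas.{u₁, u₂, u₃, 0, max u₁ u₂ u₃} A}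
    (hℒ : ℒ.IsCompatible) : ∃ ℒ' : Atlas.{u₁, u₂, u₃, 0, max u₁ u₂ u₃} A,
      ℒ'.IsCompatible ∧ ∀ K, ℒ'.IsClique K → ℒ'.InChart K := by
  obtain ⟨ℒ', hℒ', hclique⟩ := exists_inChart_of_ncard_le hℒ (Nat.card V + 1)
  refine ⟨ℒ', hℒ', fun K hK => hclique K hK ?_⟩
  by_contra! hcard
  obtain ⟨K', hK', hcard'⟩ := Set.exists_subset_card_eq hcard.le
  obtain ⟨ε, hε⟩ := hclique K' (fun b hb b' hb' => hK b (hK' hb) b' (hK' hb')) hcard'.le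
  have hle := Set.ncard_le_ncard hε
  rw [hcard', Set.ncard_range_of_injective (ℒ'.injective ε)] at hle
  exact Nat.not_succ_le_self _ hle

end Atlas

/-! ### Separation by cliques -/

namespace Atlas

variable {ℒ : Atlas.{u₁, u₂, u₃, u₄, u₅} A} {q : ℕ}

instance : Std.Symm ℒ.Adj := ⟨fun _ _ => Adj.symm⟩

/-- Every pattern with `q` colours is, on adjacent points of `C`, the relation of having the same
colour in a single partial colouring. -/
def IsColourable (q : ℕ) (C : Set ℒ.Point) : Prop :=
  ∀ g : ℒ.Pattern q, ∃ κ : ℒ.Point → WithBot (Fin q),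
    ∀ b ∈ C, ∀ b' ∈ C, ℒ.Adj b b' → (SameColour κ b b' ↔ g.1 b b')

theorem isColourable_image_proj {C : Set (ℒ.next q).Point}
    (hC : ∀ b ∈ C, ∀ b' ∈ C, ℒ.Adj (proj b) (proj b') → (ℒ.next q).Adj b b') :
    IsColourable q (proj '' C) := by
  intro g
  have hinj : Set.InjOn (proj (ℒ := ℒ) (q := q)) C := fun b hb b' hb' h =>
    (hC b hb b' hb' (h ▸ adj_self _)).eq_of_proj_eq h
  have hcolour (b : C) :=
    (Set.injOn_iff_injective.1 hinj).extend_apply (C.domRestrict (colour g)) ⊥ b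
  refine ⟨Function.extend (C.domRestrict proj) (C.domRestrict (colour g)) ⊥, ?_⟩
  rintro _ ⟨b, hb, rfl⟩ _ ⟨b', hb', rfl⟩ hbb'
  rw [← (hC b hb b' hb' hbb').sameColour_iff g]
  have hb := hcolour ⟨b, hb⟩
  have hb' := hcolour ⟨b', hb'⟩
  simp only [Set.domRestrict_apply] at hb hb'
  simp only [SameColour, hb, hb']

/-- The pattern cuts the edges between `s` and `Q`. On a chart which contains `s`, the colour of a
point tells whether it lies in `Q`. -/
theorem exists_realizes_cut {s : ℒ.Point} {D Q : Set ℒ.Point} (hs : s ∉ Q)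
    (hQ : ∀ b ∈ D \ Q, ℒ.Adj s b → ∀ b' ∈ Q, ℒ.Adj b b' → b = s) (ε : ℒ.Chart) :
    ∃ l : V → WithBot (Fin 2), Realizes ε l fun b b' =>
      (b ∈ D ∧ b' ∈ D) ∧ (b = s → b' ∉ Q) ∧ (b' = s → b ∉ Q) := by
  classical
  by_cases hsε : s ∈ Set.range (ℒ.map ε)
  · refine ⟨fun x => if ℒ.map ε x ∈ D then if ℒ.map ε x ∈ Q then 1 else 0 else ⊥, fun x y => ?_⟩
    have heq (x y) (hx : ℒ.map ε x ∈ D \ Q) (hy : ℒ.map ε y ∈ Q) : ℒ.map ε x = s :=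
      hQ _ hx ⟨ε, hsε, x, rfl⟩ _ hy ⟨ε, ⟨x, rfl⟩, y, rfl⟩
    have hxy := heq x y
    have hyx := heq y x
    have hxs : ℒ.map ε x ∈ Q → ℒ.map ε x ≠ s := (ne_of_mem_of_not_mem · hs)
    have hys : ℒ.map ε y ∈ Q → ℒ.map ε y ≠ s := (ne_of_mem_of_not_mem · hs)
    have h01 : (0 : WithBot (Fin 2)) ≠ 1 := WithBot.coe_injective.ne zero_ne_one
    by_cases hx : ℒ.map ε x ∈ D <;> by_cases hy : ℒ.map ε y ∈ D <;>
      simp only [SameColour, hx, hy, if_true, if_false, ne_eq, true_and, false_and, and_false,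
        not_true_eq_false]
    · by_cases hxQ : ℒ.map ε x ∈ Q <;> by_cases hyQ : ℒ.map ε y ∈ Q <;> simp_all [h01.symm]
    · by_cases hxQ : ℒ.map ε x ∈ Q <;> simp [hxQ]
  · refine ⟨fun x => if ℒ.map ε x ∈ D then 0 else ⊥, fun x y => ?_⟩
    have hne (x) : ℒ.map ε x ≠ s := fun h => hsε ⟨x, h⟩
    by_cases hx : ℒ.map ε x ∈ D <;> by_cases hy : ℒ.map ε y ∈ D <;> simp [SameColour, *]

theorem IsColourable.exists_separates {C : Set ℒ.Point} (hC : IsColourable 2 C) {u v : ℒ.Point}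
    (hu : u ∈ C) (hv : v ∈ C) (huv : ¬ℒ.Adj u v) :
    ∃ P Q, Separates ℒ.Adj C u v P Q ∧ ℒ.IsClique (C \ (P ∪ Q)) := by
  obtain ⟨P, Q, h⟩ := exists_maximallySeparates hu hv (fun h => huv (h ▸ adj_self u)) huv
  refine ⟨P, Q, h.toSeparates, fun s hs t ht => ?_⟩
  by_contra hst
  have hsQ : s ∉ Q := fun hQ => hs.2 (.inr hQ)
  let D := insert s (insert t (P ∪ Q))
  have hDC : D ⊆ C := Set.insert_subset hs.1
    (Set.insert_subset ht.1 (Set.union_subset h.left_subset h.right_subset))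
  have hcut : ∀ b ∈ D \ Q, ℒ.Adj s b → ∀ b' ∈ Q, ℒ.Adj b b' → b = s := by
    rintro b ⟨rfl | rfl | hb | hb, hbQ⟩ hsb b' hb' hbb'
    exacts [rfl, absurd hsb hst, absurd hbb' (h.not_adj b hb b' hb'), absurd hb hbQ]
  obtain ⟨κ, hκ⟩ := hC ⟨_, exists_realizes_cut hsQ hcut⟩
  have hne {b} (hb : b ∈ insert t (P ∪ Q)) : b ≠ s := by
    rintro rfl
    exact hb.elim (fun h => hst (h ▸ adj_self _)) hs.2
  obtain ⟨q, hq, hsq, hκq⟩ := h.exists_adj_eq hs ht (κ := κ)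
    (fun a ha p hp hap => by
      have haD : a ∈ D := Set.insert_subset_insert
        (Set.insert_subset_insert Set.subset_union_left) ha
      have hpD : p ∈ D := .inr (.inr (.inl hp))
      refine ((hκ a (hDC haD) p (hDC hpD) hap).2 ⟨⟨haD, hpD⟩, fun _ => ?_, fun hps => ?_⟩).2
      exacts [Set.disjoint_left.1 h.disjoint hp, absurd hps (hne (.inr (.inl hp)))])
    (fun a ha q hq haq => by
      have ha' : a ∈ insert t (P ∪ Q) := Set.insert_subset_insert Set.subset_union_right ha
      have hqD : q ∈ D := .inr (.inr (.inr hq))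
      refine ((hκ a (hDC (.inr ha')) q (hDC hqD) haq).2
        ⟨⟨.inr ha', hqD⟩, fun has => ?_, fun hqs => ?_⟩).2
      exacts [absurd has (hne ha'), absurd hq (hqs ▸ hsQ)])
  have hsD : s ∈ D := .inl rfl
  have hqD : q ∈ D := .inr (.inr (.inr hq))
  have hbot : κ s ≠ ⊥ := ((hκ s hs.1 s hs.1 (adj_self s)).2 ⟨⟨hsD, hsD⟩, fun _ => hsQ,
    fun _ => hsQ⟩).1
  exact ((hκ s hs.1 q (hDC hqD) hsq).1 ⟨hbot, hκq⟩).2.1 rfl hq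

end Atlas

variable {X : Type u₆} {M : Str L X}

/-! ### Developing maps -/

namespace Str

/-- The composition of two automorphisms. -/
def Aut.comp (a b : M.Aut) : M.Aut where
  perm := a.perm * b.perm
  toEquiv := b.toEquiv.trans a.toEquiv
  isEmbedding := a.isEmbedding.comp b.isEmbedding

/-- The inverse of an automorphism. -/
def Aut.symm (a : M.Aut) : M.Aut where
  perm := a.perm⁻¹
  toEquiv := a.toEquiv.symm
  isEmbedding := a.isEmbedding.symm

/-- The empty partial automorphism with a given language part. -/
def PartialAut.empty (A : Str L V) (g : L.Γ) : A.PartialAut where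
  perm := g
  dom := ∅
  cod := ∅
  dom_closed := fun _ _ h => h.elim
  cod_closed := fun _ _ h => h.elim
  toEquiv := Equiv.refl _
  isEmbedding := ⟨Function.injective_id, fun {n} _ x => (x ⟨0, n.2⟩).2.elim, fun _ x => x.2.elim⟩

end Str

namespace Atlas

section DevelopingMap

variable {ℒ : Atlas.{u₁, u₂, u₃, u₄, u₅} A} {j : A.Emb M}

/-- Some map to `M` agrees on `C` and each chart with an automorphism of `M` after `j`. The name
is borrowed from geometric structures, where a developing map glues charts with values in a
homogeneous space. -/
def HasDevelopingMap (j : A.Emb M) (C : Set ℒ.Point) : Prop :=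
  ∃ m : ℒ.Point → X, ∀ ε, ∃ θ : M.Aut, θ.perm = j.perm * ℒ.perm ε * j.perm⁻¹ ∧
    ∀ x, ℒ.map ε x ∈ C → m (ℒ.map ε x) = θ.toEquiv (j.toFun x)

theorem InChart.hasDevelopingMap (hℒ : ℒ.IsCompatible)
    (hext : ∀ f : A.PartialAut, ∃ e : M.Aut, e.Extends j f) {C : Set ℒ.Point}
    (hC : ℒ.InChart C) : HasDevelopingMap j C := by
  obtain ⟨ε₀, hε₀⟩ := hC
  obtain ⟨θ₀, hθ₀, -⟩ := hext (PartialAut.empty A (ℒ.perm ε₀))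
  refine ⟨Function.extend (ℒ.map ε₀) (θ₀.toEquiv ∘ j.toFun)
    fun b => j.toFun (ℒ.covered b).choose_spec.choose, fun ε => ?_⟩
  obtain ⟨f, hf, hdom, hmap⟩ := (hℒ.isEmbedding_map ε).exists_partialAut (hℒ.isEmbedding_map ε₀)
  obtain ⟨θ, hθ, hθf⟩ := hext f
  refine ⟨θ₀.comp θ, ?_, fun x hx => ?_⟩
  · simp only [Aut.comp, hθ₀, PartialAut.empty, hθ, hf]
    group
  · obtain ⟨y, hy⟩ := hε₀ hx
    have hxy := hmap ⟨x, hdom x y hy.symm⟩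
    simp only at hxy
    rw [hxy, (ℒ.injective ε₀).extend_apply]
    exact congrArg θ₀.toEquiv (hθf ⟨x, hdom x y hy.symm⟩).symm

/-- The developing map of `C₂` is corrected by the automorphism which makes it agree with the one
of `C₁` on a chart that contains the intersection. -/
theorem HasDevelopingMap.union {C₁ C₂ : Set ℒ.Point} (h₁ : HasDevelopingMap j C₁)
    (h₂ : HasDevelopingMap j C₂) (hchart : ℒ.InChart (C₁ ∩ C₂))
    (hadj : ∀ b ∈ C₁ \ C₂, ∀ b' ∈ C₂ \ C₁, ¬ℒ.Adj b b') : HasDevelopingMap j (C₁ ∪ C₂) := by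
  classical
  obtain ⟨m₁, h₁⟩ := h₁
  obtain ⟨m₂, h₂⟩ := h₂
  obtain ⟨ε₀, hε₀⟩ := hchart
  obtain ⟨θ₁, hp₁, hm₁⟩ := h₁ ε₀
  obtain ⟨θ₂, hp₂, hm₂⟩ := h₂ ε₀
  let σ := θ₁.comp θ₂.symm
  have hσ : σ.perm = 1 := by simp [σ, Aut.comp, Aut.symm, hp₁, hp₂]
  have hσm : ∀ b ∈ C₁ ∩ C₂, m₁ b = σ.toEquiv (m₂ b) := by
    rintro b hb
    obtain ⟨x, rfl⟩ := hε₀ hb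
    rw [hm₁ x hb.1, hm₂ x hb.2]
    simp [σ, Aut.comp, Aut.symm]
  refine ⟨C₁.piecewise m₁ (σ.toEquiv ∘ m₂), fun ε => ?_⟩
  by_cases hε : ∃ y, ℒ.map ε y ∈ C₂ \ C₁
  · obtain ⟨y, hy⟩ := hε
    obtain ⟨θ, hp, hm⟩ := h₂ ε
    refine ⟨σ.comp θ, by simp [Aut.comp, hσ, hp], fun x hx => ?_⟩
    have hx₂ : ℒ.map ε x ∈ C₂ := by
      by_contra h
      exact hadj _ ⟨hx.resolve_right h, h⟩ _ hy ⟨ε, ⟨x, rfl⟩, y, rfl⟩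
    refine Eq.trans ?_ (congrArg σ.toEquiv (hm x hx₂))
    by_cases hx₁ : ℒ.map ε x ∈ C₁
    · rw [Set.piecewise_eq_of_mem _ _ _ hx₁, hσm _ ⟨hx₁, hx₂⟩]
    · rw [Set.piecewise_eq_of_notMem _ _ _ hx₁, Function.comp_apply]
  · obtain ⟨θ, hp, hm⟩ := h₁ ε
    refine ⟨θ, hp, fun x hx => ?_⟩
    have hx₁ : ℒ.map ε x ∈ C₁ := by
      by_contra h
      exact hε ⟨x, hx.resolve_left h, h⟩
    rw [Set.piecewise_eq_of_mem _ _ _ hx₁, hm x hx₁]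

theorem HasDevelopingMap.of_image_proj {q : ℕ} {C : Set (ℒ.next q).Point}
    (h : HasDevelopingMap j (proj '' C)) : HasDevelopingMap j C := by
  obtain ⟨m, hm⟩ := h
  refine ⟨m ∘ proj, fun c => ?_⟩
  obtain ⟨θ, hp, hθ⟩ := hm c.chart
  exact ⟨θ, hp, fun x hx => hθ x ⟨_, hx, rfl⟩⟩

/-- The pairs of points of `C` without a common chart. Their number measures how far `C` is from
being a clique. -/
def nonAdj (C : Set ℒ.Point) : Set (ℒ.Point × ℒ.Point) := {p ∈ C ×ˢ C | ¬ℒ.Adj p.1 p.2}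

theorem ncard_nonAdj_le (C : Set ℒ.Point) : (nonAdj C).ncard ≤ C.ncard * C.ncard :=
  (Set.ncard_le_ncard (Set.sep_subset _ _)).trans_eq Set.ncard_prod

theorem ncard_nonAdj_lt {C C' : Set ℒ.Point} (hC : C' ⊆ C) {u v : ℒ.Point} (hu : u ∈ C)
    (hv : v ∈ C) (huv : ¬ℒ.Adj u v) (h : u ∉ C' ∨ v ∉ C') :
    (nonAdj C').ncard < (nonAdj C).ncard := by
  refine Set.ncard_lt_ncard ⟨fun p hp => ⟨⟨hC hp.1.1, hC hp.1.2⟩, hp.2⟩, fun hsub => ?_⟩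
  have huv' := (hsub (a := (u, v)) ⟨⟨hu, hv⟩, huv⟩).1
  exact h.elim (· huv'.1) (· huv'.2)

section Projection

variable {q : ℕ} {C : Set (ℒ.next q).Point}

theorem nonAdj_image_proj_subset :
    nonAdj (proj '' C) ⊆ Prod.map proj proj '' {p ∈ nonAdj C | ¬ℒ.Adj (proj p.1) (proj p.2)} := by
  rintro ⟨_, _⟩ ⟨⟨⟨b, hb, rfl⟩, b', hb', rfl⟩, hbb'⟩
  exact ⟨(b, b'), ⟨⟨⟨hb, hb'⟩, fun h => hbb' h.proj⟩, hbb'⟩, rfl⟩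

theorem ncard_nonAdj_image_proj_le : (nonAdj (proj '' C)).ncard ≤ (nonAdj C).ncard :=
  (Set.ncard_le_ncard nonAdj_image_proj_subset).trans <| (Set.ncard_image_le).trans <|
    Set.ncard_le_ncard (Set.sep_subset _ _)

theorem ncard_nonAdj_image_proj_lt {b b' : (ℒ.next q).Point} (hb : b ∈ C) (hb' : b' ∈ C)
    (hbb' : ¬(ℒ.next q).Adj b b') (hproj : ℒ.Adj (proj b) (proj b')) :
    (nonAdj (proj '' C)).ncard < (nonAdj C).ncard :=
  (Set.ncard_le_ncard nonAdj_image_proj_subset).trans_lt <| (Set.ncard_image_le).trans_lt <|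
    Set.ncard_lt_ncard ⟨Set.sep_subset _ _, fun h => (h (a := (b, b')) ⟨⟨hb, hb'⟩, hbb'⟩).2 hproj⟩

end Projection

theorem IsColourable.hasDevelopingMap (hℒ : ℒ.IsCompatible)
    (hclique : ∀ K, ℒ.IsClique K → ℒ.InChart K)
    (hext : ∀ f : A.PartialAut, ∃ e : M.Aut, e.Extends j f) {C : Set ℒ.Point}
    (hC : IsColourable 2 C)
    (hsmaller : ∀ C' : Set ℒ.Point, (nonAdj C').ncard < (nonAdj C).ncard → HasDevelopingMap j C') :
    HasDevelopingMap j C := by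
  by_cases hK : ℒ.IsClique C
  · exact (hclique C hK).hasDevelopingMap hℒ hext
  simp only [IsClique, not_forall] at hK
  obtain ⟨u, hu, v, hv, huv⟩ := hK
  obtain ⟨P, Q, h, hPQ⟩ := hC.exists_separates hu hv huv
  have hleft := hsmaller (C \ Q) <|
    ncard_nonAdj_lt Set.sdiff_subset hu hv huv (.inr fun hv => hv.2 h.right_mem)
  have hright := hsmaller (C \ P) <|
    ncard_nonAdj_lt Set.sdiff_subset hu hv huv (.inl fun hu => hu.2 h.left_mem)
  have hinter : C \ Q ∩ (C \ P) = C \ (P ∪ Q) := by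
    rw [Set.union_comm, Set.sdiff_inter_sdiff]
  have hunion : C \ Q ∪ C \ P = C := by
    rw [← Set.sdiff_inter, h.disjoint.symm.inter_eq, Set.sdiff_empty]
  rw [← hunion]
  refine hleft.union hright (hinter ▸ hclique _ hPQ) fun b hb b' hb' => h.not_adj b ?_ b' ?_
  · exact not_not.1 fun hP => hb.2 ⟨hb.1.1, hP⟩
  · exact not_not.1 fun hQ => hb'.2 ⟨hb'.1.1, hQ⟩

/-- If `proj` does not reflect adjacency on `C`, then `proj '' C` is closer to a clique than `C`;
otherwise the labels of the points of `C` colour `proj '' C`. -/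
theorem hasDevelopingMap_next (hℒ : ℒ.IsCompatible) (hclique : ∀ K, ℒ.IsClique K → ℒ.InChart K)
    (hext : ∀ f : A.PartialAut, ∃ e : M.Aut, e.Extends j f) {m : ℕ}
    (hm : ∀ C : Set ℒ.Point, (nonAdj C).ncard < m → HasDevelopingMap j C)
    {C : Set (ℒ.next 2).Point} (hC : (nonAdj C).ncard ≤ m) : HasDevelopingMap j C := by
  refine .of_image_proj ?_
  by_cases hrefl : ∀ b ∈ C, ∀ b' ∈ C, ℒ.Adj (proj b) (proj b') → (ℒ.next 2).Adj b b'
  · refine (isColourable_image_proj hrefl).hasDevelopingMap hℒ hclique hext fun C' hC' => ?_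
    exact hm C' (hC'.trans_le (ncard_nonAdj_image_proj_le.trans hC))
  · push Not at hrefl
    obtain ⟨b, hb, b', hb', hproj, hbb'⟩ := hrefl
    exact hm _ ((ncard_nonAdj_image_proj_lt hb hb' hbb' hproj).trans_le hC)

end DevelopingMap

theorem exists_hasDevelopingMap {ℒ : Atlas.{u₁, u₂, u₃, 0, max u₁ u₂ u₃} A}
    (hℒ : ℒ.IsCompatible) (hclique : ∀ K, ℒ.IsClique K → ℒ.InChart K) {j : A.Emb M}
    (hext : ∀ f : A.PartialAut, ∃ e : M.Aut, e.Extends j f) (m : ℕ) :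
    ∃ ℒ' : Atlas.{u₁, u₂, u₃, 0, max u₁ u₂ u₃} A, ℒ'.IsCompatible ∧
      (∀ K, ℒ'.IsClique K → ℒ'.InChart K) ∧
        ∀ C : Set ℒ'.Point, (nonAdj C).ncard < m → HasDevelopingMap j C := by
  induction m with
  | zero => exact ⟨ℒ, hℒ, hclique, fun C hC => (Nat.not_lt_zero _ hC).elim⟩
  | succ m ih =>
    obtain ⟨ℒ', hℒ', hclique', hm⟩ := ih
    exact ⟨ℒ'.next 2, Scheme.isCompatible_step_of_isCompatible _ hℒ',
      fun K hK => hK.inChart_of_image_proj hℒ' (hclique' _ hK.image_proj),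
      fun C hC => hasDevelopingMap_next hℒ' hclique' hext hm (Nat.lt_succ_iff.1 hC)⟩

end Atlas

namespace Atlas

variable {ℒ : Atlas.{u₁, u₂, u₃, u₄, u₅} A} {j : A.Emb M}

theorem HasDevelopingMap.exists_isEmbedding {C : Set ℒ.Point} (h : HasDevelopingMap j C) :
    ∃ m : ℒ.Point → X, ∀ ε, ∃ k : V → X, A.IsEmbedding M (j.perm * ℒ.perm ε) k ∧
      ∀ x, ℒ.map ε x ∈ C → m (ℒ.map ε x) = k x := by
  obtain ⟨m, hm⟩ := h
  refine ⟨m, fun ε => ?_⟩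
  obtain ⟨θ, hp, hθ⟩ := hm ε
  refine ⟨θ.toEquiv ∘ j.toFun, ?_, hθ⟩
  simpa [hp] using θ.isEmbedding.comp j.isEmbedding

theorem HasDevelopingMap.exists_isHomEmbedding (hℒ : ℒ.IsCompatible)
    (hclique : ∀ K, ℒ.IsClique K → ℒ.InChart K) {W : Type*} {D : Str L W} {g : L.Γ}
    {f : W → ℒ.Point} (hf : D.IsHomEmbedding ℒ.toStr g f)
    (hdev : HasDevelopingMap j (Set.range f)) : ∃ f', D.IsHomEmbedding M (j.perm * g) f' := by
  obtain ⟨m, hm⟩ := hdev.exists_isEmbedding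
  choose k hk hmk using hm
  have hmf {ε x w} (h : ℒ.map ε x = f w) : m (f w) = k ε x := by
    rw [← h, hmk ε x ⟨w, h.symm⟩]
  refine ⟨m ∘ f, ⟨fun R x hx => ?_, fun F w => ?_⟩, fun S hS hirr => ?_⟩
  · obtain ⟨ε, y, hy, hyx⟩ := hf.isHom.map_rel R x hx
    have hky := ((hk ε).map_rel _ y).1 hy
    rw [show k ε ∘ y = (m ∘ f) ∘ x from funext fun i => (hmf (congrFun hyx i)).symm] at hky
    simpa [PermLanguage.onRel] using hky
  · rintro _ ⟨w', hw', rfl⟩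
    obtain ⟨ε, x, hx, y, hy, hyw⟩ := hf.isHom.map_fn F w ⟨w', hw', rfl⟩
    have hky := ((hk ε).map_fn _ x).subset ⟨y, hy, rfl⟩
    rw [← hmf hx, ← hmf hyw] at hky
    simpa [PermLanguage.onFn] using hky
  · have hS' := hf.isEmbedding_restrict S hS hirr
    obtain ⟨ε, hε⟩ := hclique _ (hℒ.isClique_range hirr hS')
    choose a ha using fun w : S => hε ⟨w, rfl⟩
    have hfa : (fun w : S => f w) = ℒ.map ε ∘ a := funext fun w => (ha w).symm
    have hka := (hk ε).comp ((hℒ.isEmbedding_map ε).of_comp (hfa ▸ hS'))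
    rw [show k ε ∘ a = fun w : S => (m ∘ f) w from funext fun w => (hmf (ha w)).symm] at hka
    simpa [mul_assoc] using hka

/-- The chart `ε` as an embedding into the union structure. -/
def IsCompatible.emb (hℒ : ℒ.IsCompatible) (ε : ℒ.Chart) : A.Emb ℒ.toStr :=
  ⟨ℒ.perm ε, ℒ.map ε, hℒ.isEmbedding_map ε⟩

theorem IsCompatible.isCoherentEPPAWitness (hℒ : ℒ.IsCompatible) (ε : ℒ.Chart) :
    IsCoherentEPPAWitness (hℒ.emb ε) := by
  refine ⟨ℒ.aut ε ε, fun f => ⟨rfl, ℒ.extend_map ε ε f⟩, fun f g h hc => ⟨?_, ?_⟩⟩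
  · simp only [aut, hc.perm_eq]
    group
  · exact ℒ.extend_coherent ε ε ε hc

theorem IsCompatible.isIrreducibleStructureFaithful (hℒ : ℒ.IsCompatible)
    (hclique : ∀ K, ℒ.IsClique K → ℒ.InChart K) (ε : ℒ.Chart) :
    IsIrreducibleStructureFaithful (hℒ.emb ε) := by
  intro C hC hirr
  have hK := hℒ.isClique_range hirr hC.isEmbedding_val
  rw [Subtype.range_coe] at hK
  obtain ⟨ε', hε'⟩ := hclique C hK
  refine ⟨ℒ.aut ε' ε (PartialAut.refl A.isClosed_univ), ?_⟩
  rintro _ ⟨b, hb, rfl⟩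
  obtain ⟨x, rfl⟩ := hε' hb
  exact ⟨x, (ℒ.extend_map ε' ε (PartialAut.refl A.isClosed_univ) ⟨x, trivial⟩).symm⟩

end Atlas

end EPPA

theorem theorem1p5_general (L : EPPA.PermLanguage)
    {ι : Type*} {U : ι → Type*} [∀ i, Finite (U i)] (F : ∀ i, EPPA.Str L (U i))
    {n : ℕ} (hn : ∀ i, Nat.card (U i) ≤ n) {V : Type*} [Finite V] (A : EPPA.Str L V)
    (horbit : (MulAction.orbit L.Γ A).Finite) {X : Type*} (M : EPPA.Str L X)
    (hM : ¬∃ i g f, (F i).IsHomEmbedding M g f) (j : A.Emb M)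
    (hext : ∀ f : A.PartialAut, ∃ e : M.Aut, e.Extends j f) :
    ∃ (W : Type) (_ : Finite W) (B : EPPA.Str L W) (ψ : A.Emb B),
      B.ForbHE F ∧ EPPA.Str.IsCoherentEPPAWitness ψ ∧
        EPPA.Str.IsIrreducibleStructureFaithful ψ := by
  obtain ⟨_, hℒ₀⟩ := EPPA.exists_isCompatible_atlas horbit
  obtain ⟨_, hℒ₁, hclique₁⟩ := EPPA.Atlas.exists_inChart_of_isClique hℒ₀
  obtain ⟨ℒ, hℒ, hclique, hdev⟩ :=
    EPPA.Atlas.exists_hasDevelopingMap hℒ₁ hclique₁ hext (n * n + 1)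
  let ε : ℒ.Chart := Classical.arbitrary _
  refine ⟨ℒ.Point, inferInstance, ℒ.toStr, hℒ.emb ε, ⟨Finite.to_countable, ?_⟩,
    hℒ.isCoherentEPPAWitness ε, hℒ.isIrreducibleStructureFaithful hclique ε⟩
  rintro ⟨i, g, f, hf⟩
  have hcard : (Set.range f).ncard ≤ n := by
    rw [← Nat.card_coe_set_eq]
    exact (Finite.card_range_le f).trans (hn i)
  have hrange := hdev (Set.range f) <| Nat.lt_succ_of_le <|
    (EPPA.Atlas.ncard_nonAdj_le _).trans (Nat.mul_le_mul hcard hcard)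
  obtain ⟨f', hf'⟩ := hrange.exists_isHomEmbedding hℒ hclique hf
  exact hM ⟨i, _, f', hf'⟩

theorem theorem1p5 (L : EPPA.PermLanguage)
    {ι : Type*} [Finite ι] {U : ι → Type*} [∀ i, Finite (U i)] (F : ∀ i, EPPA.Str L (U i))
    {V : Type*} [Finite V] (A : EPPA.Str L V) (hA : A.ForbHE F)
    (horbit : (MulAction.orbit L.Γ A).Finite)
    {X : Type*} (M : EPPA.Str L X) (hM : M.ForbHE F)
    (j : A.Emb M) (hj : j.perm = 1)
    (hext : ∀ f : A.PartialAut, ∃ e : M.Aut, e.Extends j f) :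
    ∃ (W : Type) (_ : Finite W) (B : EPPA.Str L W) (ψ : A.Emb B),
      B.ForbHE F ∧ EPPA.Str.IsCoherentEPPAWitness ψ ∧
        EPPA.Str.IsIrreducibleStructureFaithful ψ := by
  obtain ⟨n, hn⟩ := (Set.finite_range fun i => Nat.card (U i)).bddAbove
  exact theorem1p5_general L F (fun i => hn ⟨i, rfl⟩) A horbit M hM.2 j hext
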